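/- Let $L,N\ge 1$, let $n_0,\dots,n_L\ge 1$, let $R\in\mathbb R^{n_L\times n_0}$ be a nonzero matrix, and let $x_1,\dots,x_N\in\mathbb R^{n_0}$ satisfy $\frac1N\sum_{i=1}^N x_ix_i^\top=I$. For matrices $W=(W_1,\dots,W_L)$ with $W_j\in\mathbb R^{n_j\times n_{j-1}}$, consider the squared error loss \[ f(W)=\frac1{2N}\sum_{i=1}^N\bigl\|Rx_i-W_LW_{L-1}\cdots W_1x_i\bigr\|_2^2 \] and the gradient descent algorithm $W[k+1]=W[k]-\delta\,\nabla f(W[k])$ with step size $\delta$, whose initial point $W[0]$ is drawn at random from a probability distribution that is absolutely continuous with respect to Lebesgue measure on the parameter space $\prod_{j=1}^L\mathbb R^{n_j\times n_{j-1}}$. Then the algorithm can converge to a global optimum of $f$ with positive probability only if \[ \delta\le\frac{2}{L\,\rho(R)^{2(L-1)/L}}, \] where $\rho(R)$ is the largest singular value of $R$. In other words, if $\delta$ is larger than this bound, then almost surely $W[k]$ does not converge to any global minimizer of $f$. -/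

import Mathlib

open MeasureTheory Filter Topology

namespace DeepLinear

/-- The parameter space of a deep linear network of depth `L` with layer widths
`n 0, …, n L`: all entries of all weight matrices `W_1, …, W_L`, with the Euclidean (Frobenius)
inner product and Lebesgue measure. The entry index `⟨j, a, b⟩`, with `j : Fin L`, stands for the
entry `(a, b)` of the matrix `W_{j+1}`, which has `n (j+1)` rows and `n j` columns. -/
abbrev Params {L : ℕ} (n : Fin (L + 1) → ℕ) : Type :=
  EuclideanSpace ℝ (Σ j : Fin L, Fin (n j.succ) × Fin (n j.castSucc))

/-- The weight matrix `W_{j+1}`, of size `n (j+1) × n j`. -/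
def weight {L : ℕ} {n : Fin (L + 1) → ℕ} (W : Params n) (j : Fin L) :
    Matrix (Fin (n j.succ)) (Fin (n j.castSucc)) ℝ :=
  Matrix.of fun a b => W ⟨j, (a, b)⟩

/-- The partial product `W_k ⋯ W_1` (the identity for `k = 0`). -/
def partialProd {L : ℕ} {n : Fin (L + 1) → ℕ} (W : Params n) (k : Fin (L + 1)) :
    Matrix (Fin (n k)) (Fin (n 0)) ℝ :=
  Fin.induction (motive := fun k => Matrix (Fin (n k)) (Fin (n 0)) ℝ)
    1 (fun j P => weight W j * P) k

/-- The end-to-end matrix `W_L ⋯ W_1`. -/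
def endToEnd {L : ℕ} {n : Fin (L + 1) → ℕ} (W : Params n) :
    Matrix (Fin (n (Fin.last L))) (Fin (n 0)) ℝ :=
  partialProd W (Fin.last L)

/-- The squared error loss `(1 / 2N) ∑ᵢ ‖R xᵢ - W_L ⋯ W_1 xᵢ‖₂²`. -/
noncomputable def loss {L N : ℕ} {n : Fin (L + 1) → ℕ}
    (R : Matrix (Fin (n (Fin.last L))) (Fin (n 0)) ℝ)
    (x : Fin N → EuclideanSpace ℝ (Fin (n 0))) (W : Params n) : ℝ :=
  1 / (2 * (N : ℝ)) *
    ∑ i, ‖R.toEuclideanLin (x i) - (endToEnd W).toEuclideanLin (x i)‖ ^ 2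

/-- One step of gradient descent with step size `δ` on the squared error loss. -/
noncomputable def gdStep {L N : ℕ} {n : Fin (L + 1) → ℕ}
    (R : Matrix (Fin (n (Fin.last L))) (Fin (n 0)) ℝ)
    (x : Fin N → EuclideanSpace ℝ (Fin (n 0))) (δ : ℝ) (W : Params n) : Params n :=
  W - δ • gradient (loss R x) W

/-- `W` is a global optimum of the squared error loss. -/
def IsGlobalOptimum {L N : ℕ} {n : Fin (L + 1) → ℕ}
    (R : Matrix (Fin (n (Fin.last L))) (Fin (n 0)) ℝ)
    (x : Fin N → EuclideanSpace ℝ (Fin (n 0))) (W : Params n) : Prop :=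
  ∀ V : Params n, loss R x W ≤ loss R x V

/-- The gradient descent iterates started at `W₀` converge to some global optimum. -/
def ConvergesToGlobalOptimum {L N : ℕ} {n : Fin (L + 1) → ℕ}
    (R : Matrix (Fin (n (Fin.last L))) (Fin (n 0)) ℝ)
    (x : Fin N → EuclideanSpace ℝ (Fin (n 0))) (δ : ℝ) (W₀ : Params n) : Prop :=
  ∃ W : Params n, IsGlobalOptimum R x W ∧
    Tendsto (fun k : ℕ => (gdStep R x δ)^[k] W₀) atTop (𝓝 W)

/-- The largest singular value of a real matrix (Mathlib lists singular values in decreasing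
order, starting from index `0`). -/
noncomputable def largestSingularValue {p q : ℕ} (A : Matrix (Fin p) (Fin q) ℝ) : ℝ :=
  A.toEuclideanLin.singularValues 0

end DeepLinear

/-! Gradient descent iterates the analytic map `g = id - δ ∇F`, whose derivative at `w` is `I - δ H`
with `H` the Hessian of `F`. Two facts give the theorem.

Curvature (`exists_curvature_ge`): at every global optimum `H` has a direction of curvature at least
`Λ = L ρ(R)^(2(L-1)/L)`. The optimal product `P` agrees with `R` on some unit vector `v` with `‖P v‖
= ρ(R)`, even if narrow layers prevent `P = R`. Rescaling the first layer along `v` is a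
perturbation `Y` whose image `V = H Y` is explicit: its blocks are outer products of backward and
forward passes. Cauchy-Schwarz for `H ≥ 0` gives `‖V‖⁴ ≤ H(V,V) ⟪V,Y⟫`, with `⟪V,Y⟫ = ρ(R)²`, and
AM-GM over the layers bounds `‖V‖²` below.

Instability (`volume_gradientDescent_converges_eq_zero`): if `δ Λ > 2`, then `I - δ H` stretches a
vector at every optimum, so the orbits trapped near that optimum start in a null set. Countably many
such neighbourhoods cover the optima. Preimages under `g` of null sets are null because `det Dg` is
analytic and, by `exists_regular_point`, not identically zero. Hence almost no starting point leads
to an optimum. -/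

open scoped ContDiff

/-! ### Null sets of trapped orbits and of preimages. -/

section Dynamics

variable {E : Type*} [NormedAddCommGroup E] [InnerProductSpace ℝ E] [FiniteDimensional ℝ E]

/-- For a self-adjoint `A` stretching some vector there is a quadratic form, positive at that
vector, which `A` expands strictly. -/
lemma exists_expanding_quadratic (A : E →L[ℝ] E) (hA : ∀ x y, inner ℝ (A x) y = inner ℝ x (A y))
    (e : E) (he : ‖e‖ < ‖A e‖) :
    ∃ c > 1, ∃ η > 0, 0 < ‖A e‖ ^ 2 - c * ‖e‖ ^ 2 ∧
      ∀ v, c * (‖A v‖ ^ 2 - c * ‖v‖ ^ 2) + η * ‖v‖ ^ 2 ≤ ‖A (A v)‖ ^ 2 - c * ‖A v‖ ^ 2 := by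
  have he0 : e ≠ 0 := by
    rintro rfl
    simp at he
  have hepos : 0 < ‖e‖ := norm_pos_iff.mpr he0
  have hr : 1 < ‖A e‖ ^ 2 / ‖e‖ ^ 2 := by
    rw [one_lt_div (by positivity)]
    gcongr
  -- The form is `Q v = ‖A v‖² - c ‖v‖²`. Self-adjointness gives `Q (A v) - c Q v = ‖(A² - c) v‖²`,
  -- which is bounded below by a multiple of `‖v‖²` as soon as `c` avoids the finite spectrum of
  -- `A²`.
  set B : Module.End ℝ E := ((A * A : E →L[ℝ] E) : E →ₗ[ℝ] E) with hB
  obtain ⟨c, ⟨hc1, hc2⟩, hc3⟩ :=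
    ((Set.Ioo_infinite hr).sdiff (Module.End.finite_hasEigenvalue B)).nonempty
  set T : E →L[ℝ] E := A * A - c • 1 with hT
  have hTi : Function.Injective T := by
    rw [injective_iff_map_eq_zero]
    intro v hv
    by_contra hv0
    refine hc3 (Module.End.hasEigenvalue_of_hasEigenvector (x := v) ⟨?_, hv0⟩)
    rw [Module.End.mem_eigenspace_iff]
    simpa [hT, hB, sub_eq_zero] using hv
  obtain ⟨K, hK, hKT⟩ := T.toLinearMap.exists_antilipschitzWith (LinearMap.ker_eq_bot.mpr hTi)
  refine ⟨c, hc1, ((K : ℝ) ^ 2)⁻¹, by positivity, ?_, fun v => ?_⟩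
  · rw [lt_div_iff₀ (by positivity)] at hc2
    linarith
  · have h1 : ‖v‖ ≤ K * ‖T v‖ := by
      simpa using hKT.le_mul_dist v 0
    have h2 : ((K : ℝ) ^ 2)⁻¹ * ‖v‖ ^ 2 ≤ ‖T v‖ ^ 2 := by
      rw [inv_mul_le_iff₀ (by positivity), ← mul_pow]
      gcongr
    have h3 : ‖T v‖ ^ 2 = ‖A (A v)‖ ^ 2 - 2 * c * ‖A v‖ ^ 2 + c ^ 2 * ‖v‖ ^ 2 := by
      have : T v = A (A v) - c • v := by simp [hT]
      rw [this, norm_sub_sq_real, inner_smul_right, hA, real_inner_self_eq_norm_sq, norm_smul,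
        mul_pow, Real.norm_eq_abs, sq_abs]
      ring
    linarith

/-- A set that every line in the direction `e` meets in at most one point is null. -/
lemma volume_eq_zero_of_subsingleton_lines [MeasurableSpace E] [BorelSpace E] {S : Set E}
    (hS : MeasurableSet S) {e : E}
    (h : ∀ x ∈ S, ∀ t : ℝ, t ≠ 0 → x + t • e ∉ S) : volume S = 0 := by
  have := ae_mem_of_ae_add_linearMap_mem (LinearMap.toSpanSingleton ℝ E e)
    (volume : Measure ℝ) (volume : Measure E) (s := Sᶜ) hS.compl (fun y => by
      have hsub : {t : ℝ | ¬ (y + LinearMap.toSpanSingleton ℝ E e t ∈ Sᶜ)}.Subsingleton := by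
        intro s hs t ht
        simp only [Set.mem_compl_iff, not_not, Set.mem_ofPred_eq,
          LinearMap.toSpanSingleton_apply] at hs ht
        by_contra hst
        refine h _ hs (t - s) (sub_ne_zero.mpr (Ne.symm hst)) ?_
        rwa [add_assoc, ← add_smul, add_sub_cancel]
      exact hsub.measure_zero _)
  rw [ae_iff] at this
  simpa using this

/-- Near a point where the derivative is self-adjoint and stretches some vector, the set of points
with a whole forward orbit in a small neighbourhood is null. -/
lemma exists_nhds_volume_trapped_eq_zero [MeasurableSpace E] [BorelSpace E] {g : E → E}
    (hg : Continuous g) {x₀ : E} {A : E →L[ℝ] E} (hgA : HasStrictFDerivAt g A x₀)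
    (hA : ∀ x y, inner ℝ (A x) y = inner ℝ x (A y)) {e : E} (he : ‖e‖ < ‖A e‖) :
    ∃ U ∈ 𝓝 x₀, volume {x | ∀ k : ℕ, g^[k] x ∈ U} = 0 := by
  obtain ⟨c, hc, η, hη, hQe, hQ⟩ := exists_expanding_quadratic A hA e he
  set Q : E → ℝ := fun v => ‖A v‖ ^ 2 - c * ‖v‖ ^ 2 with hQdef
  set M : ℝ := ‖A‖ with hM
  have hM0 : 0 ≤ M := norm_nonneg _
  -- The error `r` of linearization costs at most `ε (2M³ + 2cM + c) ‖v‖²` in `Q (A v + r)`; this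
  -- `ε` lets the gain `η ‖v‖²` absorb it.
  obtain ⟨ε, hε0, hε1, hε⟩ : ∃ ε : ℝ, 0 < ε ∧ ε ≤ 1 ∧
      ε * (2 * M ^ 3 + 2 * c * M + c) ≤ η := by
    have hC : 0 < 2 * M ^ 3 + 2 * c * M + c := by positivity
    refine ⟨min 1 (η / (2 * M ^ 3 + 2 * c * M + c)), by positivity, min_le_left _ _, ?_⟩
    calc _ ≤ η / (2 * M ^ 3 + 2 * c * M + c) * (2 * M ^ 3 + 2 * c * M + c) := by
          gcongr
          exact min_le_right _ _
      _ = η := by field_simp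
  have key : ∀ v r : E, ‖r‖ ≤ ε * ‖v‖ → c * Q v ≤ Q (A v + r) := by
    intro v r hr
    have hv0 : 0 ≤ ‖v‖ := norm_nonneg v
    have hAv : ‖A v‖ ≤ M * ‖v‖ := A.le_opNorm v
    have hAAv : ‖A (A v)‖ ≤ M * (M * ‖v‖) := (A.le_opNorm _).trans (by gcongr)
    have hAr : ‖A r‖ ≤ M * (ε * ‖v‖) := (A.le_opNorm _).trans (by gcongr)
    have e1 : ‖A (A v + r)‖ ^ 2 = ‖A (A v)‖ ^ 2 + 2 * inner ℝ (A (A v)) (A r) + ‖A r‖ ^ 2 := by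
      rw [map_add, norm_add_sq_real]
    have e2 : ‖A v + r‖ ^ 2 = ‖A v‖ ^ 2 + 2 * inner ℝ (A v) r + ‖r‖ ^ 2 := norm_add_sq_real _ _
    have i1 : -(M ^ 3 * ε * ‖v‖ ^ 2) ≤ inner ℝ (A (A v)) (A r) := by
      have h1 := (abs_le.mp (abs_real_inner_le_norm (A (A v)) (A r))).1
      have h2 : ‖A (A v)‖ * ‖A r‖ ≤ M * (M * ‖v‖) * (M * (ε * ‖v‖)) := by gcongr
      linarith
    have i2 : inner ℝ (A v) r ≤ M * ε * ‖v‖ ^ 2 := by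
      have h1 := real_inner_le_norm (A v) r
      have h2 : ‖A v‖ * ‖r‖ ≤ M * ‖v‖ * (ε * ‖v‖) := by gcongr
      linarith
    have i3 : ‖r‖ ^ 2 ≤ ε * ‖v‖ ^ 2 := by
      calc ‖r‖ ^ 2 ≤ (ε * ‖v‖) ^ 2 := by gcongr
        _ = ε * ε * ‖v‖ ^ 2 := by ring
        _ ≤ 1 * ε * ‖v‖ ^ 2 := by gcongr
        _ = _ := by ring
    have hb := hQ v
    simp only [hQdef]
    rw [e1, e2]
    have hc0 : 0 < c := by linarith
    have j2 := mul_le_mul_of_nonneg_left i2 hc0.le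
    have j3 := mul_le_mul_of_nonneg_left i3 hc0.le
    have j4 : ε * (2 * M ^ 3 + 2 * c * M + c) * ‖v‖ ^ 2 ≤ η * ‖v‖ ^ 2 := by gcongr
    nlinarith [sq_nonneg ‖A r‖]
  obtain ⟨s, hs, hgs⟩ := hgA.approximates_deriv_on_nhds (c := ⟨ε, hε0.le⟩) (Or.inr hε0)
  obtain ⟨r, hr, hrs⟩ := Metric.nhds_basis_closedBall.mem_iff.mp hs
  refine ⟨Metric.closedBall x₀ r, Metric.closedBall_mem_nhds _ hr, ?_⟩
  have hclosed : IsClosed {x | ∀ k : ℕ, g^[k] x ∈ Metric.closedBall x₀ r} := by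
    simp only [Set.ofPred_forall]
    exact isClosed_iInter fun k => Metric.isClosed_closedBall.preimage (hg.iterate k)
  refine volume_eq_zero_of_subsingleton_lines hclosed.measurableSet (e := e) ?_
  -- For two trapped points differing by `t • e`, the form `Q` of the difference starts positive and
  -- grows like `c ^ k`, while it stays bounded in the ball.
  intro x hx t ht hy
  set y := x + t • e with hyd
  have hQ0 : 0 < Q (y - x) := by
    have : Q (y - x) = t ^ 2 * (‖A e‖ ^ 2 - c * ‖e‖ ^ 2) := by
      simp only [hQdef, hyd, add_sub_cancel_left, map_smul, norm_smul, mul_pow, Real.norm_eq_abs,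
        sq_abs]
      ring
    rw [this]
    positivity
  have grow : ∀ k : ℕ, c ^ k * Q (y - x) ≤ Q (g^[k] y - g^[k] x) := by
    intro k
    induction k with
    | zero => simp
    | succ k ih =>
      rw [Function.iterate_succ_apply', Function.iterate_succ_apply']
      have h1 := hgs _ (hrs (hy k)) _ (hrs (hx k))
      have h2 := key _ _ h1
      rw [add_sub_cancel] at h2
      refine le_trans ?_ h2
      rw [pow_succ']
      nlinarith
  have bdd : ∀ k : ℕ, Q (g^[k] y - g^[k] x) ≤ (M * (2 * r)) ^ 2 := by
    intro k
    have h1 : ‖g^[k] y - g^[k] x‖ ≤ 2 * r := by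
      have h1 := Metric.mem_closedBall.mp (hy k)
      have h2 := Metric.mem_closedBall.mp (hx k)
      have h3 := dist_triangle_right (g^[k] y) (g^[k] x) x₀
      rw [← dist_eq_norm]
      linarith
    have h2 : ‖A (g^[k] y - g^[k] x)‖ ≤ M * (2 * r) := (A.le_opNorm _).trans (by gcongr)
    have h3 : ‖A (g^[k] y - g^[k] x)‖ ^ 2 ≤ (M * (2 * r)) ^ 2 := by gcongr
    simp only [hQdef]
    have : 0 ≤ c * ‖g^[k] y - g^[k] x‖ ^ 2 := by positivity
    linarith
  obtain ⟨k, hk⟩ := pow_unbounded_of_one_lt ((M * (2 * r)) ^ 2 / Q (y - x)) hc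
  rw [div_lt_iff₀ hQ0] at hk
  linarith [grow k, bdd k]

/-- Preimages of null sets are null if the derivative is almost everywhere injective. -/
lemma volume_preimage_eq_zero [MeasurableSpace E] [BorelSpace E] {g : E → E}
    (hg : ContDiff ℝ 1 g) (hdet : ∀ᵐ x, (fderiv ℝ g x).det ≠ 0) {Z : Set E}
    (hZ : volume Z = 0) : volume (g ⁻¹' Z) = 0 := by
  set Z' := toMeasurable volume Z
  have hZ' : volume Z' = 0 := by rwa [measure_toMeasurable]
  have hm : MeasurableSet (g ⁻¹' Z') := (measurableSet_toMeasurable _ _).preimage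
    hg.continuous.measurable
  set D := {x | (fderiv ℝ g x).det ≠ 0}
  have hcov : volume (g ⁻¹' Z' ∩ D) = 0 := by
    -- Locally `g` is injective by the inverse function theorem, so the integral of `|det Dg|` over
    -- the preimage is the measure of a subset of `Z'`, which is zero although the integrand is
    -- nonzero on `D`.
    refine measure_null_of_locally_null _ fun x hx => ?_
    have hx' : (fderiv ℝ g x).det ≠ 0 := hx.2
    set A : E ≃L[ℝ] E := (fderiv ℝ g x).toContinuousLinearEquivOfDetNeZero hx'
    have hs : HasStrictFDerivAt g (A : E →L[ℝ] E) x := by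
      have : ((A : E →L[ℝ] E)) = fderiv ℝ g x := by ext v; rfl
      rw [this]
      exact hg.contDiffAt.hasStrictFDerivAt one_ne_zero
    set Φ := hs.toOpenPartialHomeomorph g
    have hsrc : Φ.source ∈ 𝓝 x :=
      Φ.open_source.mem_nhds hs.mem_toOpenPartialHomeomorph_source
    refine ⟨(g ⁻¹' Z' ∩ D) ∩ Φ.source, inter_mem_nhdsWithin _ hsrc, ?_⟩
    have hms : MeasurableSet (g ⁻¹' Z' ∩ Φ.source) := hm.inter Φ.open_source.measurableSet
    have hinj : Set.InjOn g (g ⁻¹' Z' ∩ Φ.source) := Φ.injOn.mono Set.inter_subset_right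
    have h0 := lintegral_abs_det_fderiv_eq_addHaar_image volume hms
      (fun y _ => (hg.differentiable one_ne_zero y).hasFDerivAt.hasFDerivWithinAt) hinj
    have h1 : volume (g '' (g ⁻¹' Z' ∩ Φ.source)) = 0 :=
      measure_mono_null (by rintro _ ⟨y, hy, rfl⟩; exact hy.1) hZ'
    rw [h1, lintegral_eq_zero_iff' ?_] at h0
    · rw [Filter.EventuallyEq, ae_restrict_iff' hms, ae_iff] at h0
      refine measure_mono_null ?_ h0
      rintro y ⟨⟨hy1, hy2⟩, hy3⟩
      simp only [Set.mem_ofPred_eq, Classical.not_imp]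
      exact ⟨⟨hy1, hy3⟩, by simpa using Set.mem_ofPred_eq.mp hy2⟩
    · refine Measurable.aemeasurable ?_
      have : Continuous fun y => (fderiv ℝ g y).det :=
        ContinuousLinearMap.continuous_det.comp (hg.continuous_fderiv one_ne_zero)
      exact ENNReal.measurable_ofReal.comp this.abs.measurable
  refine measure_mono_null (t := (g ⁻¹' Z' ∩ D) ∪ Dᶜ) ?_ (measure_union_null hcov ?_)
  · intro x hx
    by_cases hxD : x ∈ D
    · exact Or.inl ⟨subset_toMeasurable _ _ hx, hxD⟩
    · exact Or.inr hxD
  · exact hdet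

end Dynamics

lemma second_fderiv_symm {E : Type*} [NormedAddCommGroup E]
    [InnerProductSpace ℝ E] {F : E → ℝ} (hF : ContDiff ℝ ω F) (x z y : E) :
    fderiv ℝ (fderiv ℝ F) x z y = fderiv ℝ (fderiv ℝ F) x y z := by
  have : IsSymmSndFDerivAt ℝ F x := hF.contDiffAt.isSymmSndFDerivAt (by simp)
  exact this.eq z y

/-! ### Gradient descent as an analytic dynamical system. -/

section Dynamics

variable {E : Type*} [NormedAddCommGroup E] [InnerProductSpace ℝ E] [FiniteDimensional ℝ E]

/-- The zero set of a real analytic function that is not identically zero is null. -/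
lemma ae_ne_zero_of_contDiff_omega [MeasurableSpace E] [BorelSpace E] {D : E → ℝ}
    (hD : ContDiff ℝ ω D) {x₀ : E} (h0 : D x₀ ≠ 0) : ∀ᵐ x, D x ≠ 0 := by
  have hcont : Continuous fun p : ℝ × E => D (x₀ + p.1 • p.2) :=
    hD.continuous.comp (by fun_prop)
  have hmeas : MeasurableSet {p : ℝ × E | D (x₀ + p.1 • p.2) ≠ 0} :=
    (isOpen_ne.preimage hcont).measurableSet
  -- On each line through `x₀` the restriction is analytic and nonzero at `t = 0`, so its zeros are
  -- isolated. Fubini then gives some `t ≠ 0` that is good for almost every `v`, and `v ↦ x₀ + t •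
  -- v` preserves null sets in both directions.
  have h1 : ∀ᵐ v : E, ∀ᵐ t : ℝ, D (x₀ + t • v) ≠ 0 := by
    refine ae_of_all _ fun v => ?_
    have hcd : ContDiff ℝ ω (fun t : ℝ => D (x₀ + t • v)) := hD.comp (by fun_prop)
    have han : AnalyticOnNhd ℝ (fun t : ℝ => D (x₀ + t • v)) Set.univ :=
      fun t _ => hcd.contDiffAt.analyticAt
    rw [ae_iff]
    simp only [not_not]
    refine measure_null_of_locally_null _ fun t _ => ?_
    rcases (han t trivial).eventually_eq_zero_or_eventually_ne_zero with h | h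
    · have := han.eqOn_zero_of_preconnected_of_eventuallyEq_zero isPreconnected_univ trivial h
      exact absurd (this (Set.mem_univ 0)) (by simpa using h0)
    · refine ⟨{t}, ?_, by simp⟩
      rw [eventually_nhdsWithin_iff] at h
      refine mem_nhdsWithin_iff_eventually.mpr (h.mono fun s hs hs0 => ?_)
      by_contra hst
      exact hs hst hs0
  have h2 : ∀ᵐ t : ℝ, ∀ᵐ v : E, D (x₀ + t • v) ≠ 0 :=
    (Measure.ae_ae_comm (p := fun (t : ℝ) (v : E) => D (x₀ + t • v) ≠ 0) hmeas).mpr h1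
  obtain ⟨t, ht, ht0⟩ := (h2.and (Measure.ae_ne volume 0)).exists
  rw [ae_iff] at ht ⊢
  simp only [not_not] at ht ⊢
  have h3 : {v : E | D (x₀ + t • v) = 0} =
      (t • · : E → E) ⁻¹' ((x₀ + ·) ⁻¹' {x | D x = 0}) := rfl
  rw [h3, Measure.addHaar_preimage_smul _ ht0, measure_preimage_add] at ht
  simpa [ht0] using ht

/-- Gradient descent on an analytic function avoids, from almost every starting point, every set
of critical points at which some curvature exceeds `2 / δ`. -/
theorem volume_gradientDescent_converges_eq_zero [MeasurableSpace E] [BorelSpace E] {F : E → ℝ}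
    (hF : ContDiff ℝ ω F) (δ : ℝ) (C : Set E)
    (hC : ∀ x ∈ C, ∃ v : E, 2 * ‖v‖ ^ 2 < δ * fderiv ℝ (fderiv ℝ F) x v v)
    {x₁ : E} (hx₁ : ∀ z : E, (∀ y, inner ℝ z y = δ * fderiv ℝ (fderiv ℝ F) x₁ z y) → z = 0) :
    volume {x | ∃ w ∈ C, Tendsto (fun k : ℕ => (fun y => y - δ • gradient F y)^[k] x)
      atTop (𝓝 w)} = 0 := by
  set g : E → E := fun y => y - δ • gradient F y with hgdef
  set J : (E →L[ℝ] ℝ) →L[ℝ] E := LinearMap.toContinuousLinearMap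
    { toFun := (InnerProductSpace.toDual ℝ E).symm
      map_add' := map_add _
      map_smul' := by simp } with hJ
  have hJi : ∀ l y, inner ℝ (J l) y = l y := fun l y =>
    InnerProductSpace.toDual_symm_apply
  have hgrad : ContDiff ℝ ω (gradient F) := J.contDiff.comp (hF.fderiv_right le_top)
  have hg : ContDiff ℝ ω g := contDiff_id.sub (contDiff_const.smul hgrad)
  have hdF : ∀ x, DifferentiableAt ℝ (fderiv ℝ F) x := fun x =>
    (hF.fderiv_right (m := 1) (by simp)).differentiable one_ne_zero x
  have hinner : ∀ x z y, inner ℝ (fderiv ℝ g x z) y =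
      inner ℝ z y - δ * fderiv ℝ (fderiv ℝ F) x z y := by
    intro x z y
    have h1 : HasFDerivAt (gradient F) (J.comp (fderiv ℝ (fderiv ℝ F) x)) x :=
      J.hasFDerivAt.comp x (hdF x).hasFDerivAt
    have h2 : HasFDerivAt g _ x := (hasFDerivAt_id x).sub (h1.const_smul δ)
    rw [h2.fderiv]
    simp [inner_sub_left, inner_smul_left, hJi]
  have hdet : ∀ᵐ x, (fderiv ℝ g x).det ≠ 0 := by
    refine ae_ne_zero_of_contDiff_omega (x₀ := x₁) ?_ ?_
    · have : ContDiff ℝ ω (fderiv ℝ g) := hg.fderiv_right le_top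
      set b := Module.finBasis ℝ E
      have hb : ∀ x, (fderiv ℝ g x).det =
          (Matrix.of fun i j => b.equivFunL (fderiv ℝ g x (b j)) i).det := by
        intro x
        rw [ContinuousLinearMap.det, ← LinearMap.det_toMatrix b]
        congr 1
        ext i j
        simp [LinearMap.toMatrix_apply]
      simp_rw [hb, Matrix.det_apply, Matrix.of_apply]
      refine ContDiff.sum fun σ _ => ContDiff.const_smul _ (contDiff_prod fun i _ => ?_)
      have h1 : ContDiff ℝ ω fun x => b.equivFunL (fderiv ℝ g x (b i)) :=
        b.equivFunL.contDiff.comp (this.clm_apply contDiff_const)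
      exact contDiff_pi.mp h1 _
    · intro h
      have h' : LinearMap.det (fderiv ℝ g x₁ : E →ₗ[ℝ] E) = 0 := h
      obtain ⟨z, hz, hz0⟩ := (Submodule.ne_bot_iff _).mp
        (LinearMap.bot_lt_ker_of_det_eq_zero h').ne'
      refine hz0 (hx₁ z fun y => ?_)
      have h3 := hinner x₁ z y
      have hz' : fderiv ℝ g x₁ z = 0 := hz
      rw [hz', inner_zero_left] at h3
      linarith
  have hloc : ∀ w ∈ C, ∃ U, (IsOpen U ∧ w ∈ U) ∧ volume {x | ∀ k : ℕ, g^[k] x ∈ U} = 0 := by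
    intro w hw
    obtain ⟨v, hv⟩ := hC w hw
    suffices h : ∃ U ∈ 𝓝 w, volume {x | ∀ k : ℕ, g^[k] x ∈ U} = 0 by
      obtain ⟨U, hU, hU0⟩ := h
      obtain ⟨V, hVU, hV, hwV⟩ := mem_nhds_iff.mp hU
      exact ⟨V, ⟨hV, hwV⟩, measure_mono_null (fun x hx k => hVU (hx k)) hU0⟩
    refine exists_nhds_volume_trapped_eq_zero hg.continuous
      (hg.contDiffAt.hasStrictFDerivAt (by simp)) (fun x y => ?_) (e := v) ?_
    · rw [← real_inner_comm x (fderiv ℝ g w y), hinner, hinner, second_fderiv_symm hF, real_inner_comm]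
    -- Here `⟪Dg v, v⟫ = ‖v‖² - δ H(v,v) < -‖v‖²`, so Cauchy-Schwarz forces `‖Dg v‖ > ‖v‖`.
    · have h1 := hinner w v v
      rw [real_inner_self_eq_norm_sq] at h1
      have h2 := (abs_le.mp (abs_real_inner_le_norm (fderiv ℝ g w v) v)).1
      by_contra! h3
      nlinarith [norm_nonneg v]
  choose! U hU hUnull using hloc
  obtain ⟨T, hTC, hTc, hT⟩ := TopologicalSpace.countable_cover_nhdsWithin
    (f := U) (s := C) (fun w hw => mem_nhdsWithin_of_mem_nhds ((hU w hw).1.mem_nhds (hU w hw).2))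
  -- A convergent orbit is trapped only from some time `m` on, hence the pullback by `g^[m]`.
  have hnull : ∀ w ∈ T, ∀ m : ℕ, volume ((g^[m]) ⁻¹' {x | ∀ k : ℕ, g^[k] x ∈ U w}) = 0 := by
    intro w hw m
    induction m with
    | zero => exact hUnull w (hTC hw)
    | succ m ih =>
      rw [Function.iterate_succ, Set.preimage_comp]
      exact volume_preimage_eq_zero (hg.of_le le_top) hdet ih
  refine measure_mono_null (t := ⋃ w ∈ T, ⋃ m : ℕ, (g^[m]) ⁻¹' {x | ∀ k : ℕ, g^[k] x ∈ U w}) ?_ ?_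
  · rintro x ⟨w, hw, hx⟩
    obtain ⟨i, hi, hwi⟩ := Set.mem_iUnion₂.mp (hT hw)
    obtain ⟨m, hm⟩ := eventually_atTop.mp
      (hx.eventually ((hU i (hTC hi)).1.mem_nhds hwi))
    refine Set.mem_iUnion₂.mpr ⟨i, hi, Set.mem_iUnion.mpr ⟨m, fun k => ?_⟩⟩
    rw [← Function.iterate_add_apply]
    exact hm _ (Nat.le_add_left m k)
  · exact (measure_biUnion_null_iff hTc).mpr fun w hw => measure_iUnion_null fun m => hnull w hw m

end Dynamics

/-! ### Second derivatives along lines and at minima. -/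

section SecondOrder

variable {E : Type*} [NormedAddCommGroup E] [InnerProductSpace ℝ E]

lemma hasDerivAt_fderiv_along {F : E → ℝ} (hF : ContDiff ℝ ω F) (w z y : E) (t : ℝ) :
    HasDerivAt (fun t : ℝ => fderiv ℝ F (w + t • z) y)
      (fderiv ℝ (fderiv ℝ F) (w + t • z) z y) t := by
  have h1 : HasFDerivAt (fderiv ℝ F) (fderiv ℝ (fderiv ℝ F) (w + t • z)) (w + t • z) :=
    ((hF.fderiv_right (m := 1) (by simp)).differentiable one_ne_zero _).hasFDerivAt
  have h2 : HasDerivAt (fun t : ℝ => w + t • z) z t := by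
    simpa using ((hasDerivAt_id t).smul_const z).const_add w
  have h3 := h1.comp_hasDerivAt t h2
  simpa using h3.clm_apply (hasDerivAt_const t y)

lemma hasDerivAt_along {F : E → ℝ} (hF : ContDiff ℝ ω F) (w z : E) (t : ℝ) :
    HasDerivAt (fun t : ℝ => F (w + t • z)) (fderiv ℝ F (w + t • z) z) t := by
  have h2 : HasDerivAt (fun t : ℝ => w + t • z) z t := by
    simpa using ((hasDerivAt_id t).smul_const z).const_add w
  exact ((hF.differentiable (by simp) _).hasFDerivAt).comp_hasDerivAt t h2

lemma deriv_deriv_along {F : E → ℝ} (hF : ContDiff ℝ ω F) (w z : E) :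
    deriv (deriv fun t : ℝ => F (w + t • z)) 0 = fderiv ℝ (fderiv ℝ F) w z z := by
  have h1 : deriv (fun t : ℝ => F (w + t • z)) = fun t => fderiv ℝ F (w + t • z) z :=
    funext fun t => (hasDerivAt_along hF w z t).deriv
  rw [h1]
  simpa using (hasDerivAt_fderiv_along hF w z z 0).deriv

/-- Second-order necessary condition at a global minimum. -/
lemma second_fderiv_nonneg_of_forall_le {F : E → ℝ} (hF : ContDiff ℝ ω F) {w : E}
    (hw : ∀ y, F w ≤ F y) (z : E) : 0 ≤ fderiv ℝ (fderiv ℝ F) w z z := by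
  by_contra! h
  set f : ℝ → ℝ := fun t => F (w + t • z) with hf
  have hmin : IsLocalMin f 0 := Eventually.of_forall fun t => by simpa [hf] using hw _
  rw [← deriv_deriv_along hF] at h
  have hmax : IsLocalMax f 0 := isLocalMax_of_deriv_deriv_neg h hmin.deriv_eq_zero
    (hasDerivAt_along hF w z 0).continuousAt
  have hconst : f =ᶠ[𝓝 0] fun _ => f 0 := by
    filter_upwards [hmin, hmax] with t h1 h2 using le_antisymm h2 h1
  have := hconst.deriv.deriv_eq
  simp at this
  exact h.ne this

lemma fderiv_eq_zero_of_forall_le {F : E → ℝ} {w : E} (hw : ∀ y, F w ≤ F y) :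
    fderiv ℝ F w = 0 :=
  IsLocalMin.fderiv_eq_zero (Eventually.of_forall hw)

/-- If the Hessian at a global minimum maps some `y` to `v`, its curvature along `v` is at least
`‖v‖⁴ / ⟪v, y⟫`. -/
lemma norm_pow_four_le_curvature {F : E → ℝ} (hF : ContDiff ℝ ω F) {w : E}
    (hw : ∀ y, F w ≤ F y) {v y : E} (hvy : 0 < inner ℝ v y)
    (h : ∀ z, fderiv ℝ (fderiv ℝ F) w z y = inner ℝ v z) :
    ‖v‖ ^ 4 ≤ fderiv ℝ (fderiv ℝ F) w v v * inner ℝ v y := by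
  set c := inner ℝ v y with hc
  -- This is Cauchy-Schwarz for the semidefinite Hessian: the vector is the usual minimizing
  -- combination, with `H(v,y) = ‖v‖²` and `H(y,y) = c`.
  have h0 := second_fderiv_nonneg_of_forall_le hF hw (c • v - ‖v‖ ^ 2 • y)
  simp only [map_sub, map_smul, sub_apply, smul_apply,
    smul_eq_mul] at h0
  rw [second_fderiv_symm hF w y v, h v, h y, real_inner_self_eq_norm_sq, ← hc] at h0
  have : 0 ≤ c * (fderiv ℝ (fderiv ℝ F) w v v * c - ‖v‖ ^ 4) := by linarith
  linarith [nonneg_of_mul_nonneg_right this hvy]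

end SecondOrder

open Matrix

/-! ### The Frobenius inner product. -/

section Frobenius

variable {p q : Type*} [Fintype p] [Fintype q]

/-- The Frobenius inner product of two real matrices. -/
def frobInner (A B : Matrix p q ℝ) : ℝ := (Aᵀ * B).trace

lemma frobInner_comm (A B : Matrix p q ℝ) : frobInner A B = frobInner B A := by
  rw [frobInner, ← trace_transpose, transpose_mul, transpose_transpose, frobInner]

lemma frobInner_add_right (A B C : Matrix p q ℝ) :
    frobInner A (B + C) = frobInner A B + frobInner A C := by
  simp [frobInner, Matrix.mul_add]

lemma frobInner_sub_right (A B C : Matrix p q ℝ) :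
    frobInner A (B - C) = frobInner A B - frobInner A C := by
  simp [frobInner, Matrix.mul_sub]

lemma frobInner_smul_right (A B : Matrix p q ℝ) (t : ℝ) :
    frobInner A (t • B) = t * frobInner A B := by
  simp [frobInner]

lemma frobInner_add_left (A B C : Matrix p q ℝ) :
    frobInner (A + B) C = frobInner A C + frobInner B C := by
  simp [frobInner_comm _ C, frobInner_add_right]

lemma frobInner_sub_left (A B C : Matrix p q ℝ) :
    frobInner (A - B) C = frobInner A C - frobInner B C := by
  simp [frobInner_comm _ C, frobInner_sub_right]

lemma frobInner_smul_left (A B : Matrix p q ℝ) (t : ℝ) :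
    frobInner (t • A) B = t * frobInner A B := by
  simp [frobInner_comm _ B, frobInner_smul_right]

lemma frobInner_eq_sum (A B : Matrix p q ℝ) : frobInner A B = ∑ i, ∑ j, A i j * B i j := by
  rw [Finset.sum_comm]
  simp [frobInner, trace, mul_apply]

lemma frobInner_self_nonneg (A : Matrix p q ℝ) : 0 ≤ frobInner A A := by
  rw [frobInner_eq_sum]
  exact Finset.sum_nonneg fun i _ => Finset.sum_nonneg fun j _ => mul_self_nonneg _

lemma frobInner_self_eq_zero {A : Matrix p q ℝ} : frobInner A A = 0 ↔ A = 0 := by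
  simpa [frobInner] using trace_conjTranspose_mul_self_eq_zero_iff (A := A)

lemma frobInner_vecMulVec (A : Matrix p q ℝ) (u : p → ℝ) (v : q → ℝ) :
    frobInner A (vecMulVec u v) = u ⬝ᵥ A *ᵥ v := by
  simp only [frobInner_eq_sum, vecMulVec_apply, dotProduct, mulVec, Finset.mul_sum]
  exact Finset.sum_congr rfl fun i _ => Finset.sum_congr rfl fun j _ => by ring

lemma frobInner_mul_left_eq {r : Type*} [Fintype r] (A : Matrix p q ℝ) (B : Matrix p r ℝ)
    (C : Matrix r q ℝ) : frobInner A (B * C) = frobInner (Bᵀ * A) C := by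
  simp [frobInner, Matrix.mul_assoc]

lemma frobInner_mul_right_eq {r : Type*} [Fintype r] (A : Matrix p q ℝ) (B : Matrix p r ℝ)
    (C : Matrix r q ℝ) : frobInner A (B * C) = frobInner (A * Cᵀ) B := by
  simp only [frobInner, transpose_mul, transpose_transpose]
  rw [← Matrix.mul_assoc, trace_mul_comm, Matrix.mul_assoc]

end Frobenius

/-! ### Singular vectors and best approximation. -/

lemma eq_zero_of_forall_quadratic_nonneg {a b : ℝ} (h : ∀ t : ℝ, 0 ≤ t ^ 2 * b - 2 * t * a) :
    a = 0 := by
  by_contra ha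
  have h1 := discrim_le_zero (a := b) (b := -2 * a) (c := 0) (fun t => by linarith [h t])
  have : 0 < a ^ 2 := by positivity
  simp [discrim] at h1
  exact ha h1

lemma exists_top_singular_vector {p q : ℕ} (hq : 0 < q) (A : Matrix (Fin p) (Fin q) ℝ) :
    ∃ v : Fin q → ℝ, v ⬝ᵥ v = 1 ∧
      Aᵀ *ᵥ (A *ᵥ v) = DeepLinear.largestSingularValue A ^ 2 • v ∧
      ∀ x : Fin q → ℝ, (A *ᵥ x) ⬝ᵥ (A *ᵥ x) ≤
        DeepLinear.largestSingularValue A ^ 2 * (x ⬝ᵥ x) := by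
  set T := A.toEuclideanLin with hT
  have hfr : Module.finrank ℝ (EuclideanSpace ℝ (Fin q)) = q := by simp
  have hρ : DeepLinear.largestSingularValue A = T.singularValues 0 := rfl
  have hadj : LinearMap.adjoint T = Aᵀ.toEuclideanLin := by
    rw [hT, ← Matrix.toEuclideanLin_conjTranspose_eq_adjoint, conjTranspose_eq_transpose_of_trivial]
  have hS := T.isSymmetric_adjoint_comp_self
  set b := hS.eigenvectorBasis hfr
  have hb : ∀ i, LinearMap.adjoint T (T (b i)) = hS.eigenvalues hfr i • b i :=
    fun i => hS.apply_eigenvectorBasis hfr i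
  have hdot : ∀ x y : Fin q → ℝ, inner ℝ (WithLp.toLp 2 x) (WithLp.toLp 2 y) = x ⬝ᵥ y := by
    intro x y
    simp [EuclideanSpace.inner_eq_star_dotProduct, dotProduct_comm]
  have hdot' : ∀ x y : Fin p → ℝ, inner ℝ (WithLp.toLp 2 x) (WithLp.toLp 2 y) = x ⬝ᵥ y := by
    intro x y
    simp [EuclideanSpace.inner_eq_star_dotProduct, dotProduct_comm]
  refine ⟨(b ⟨0, hq⟩).ofLp, ?_, ?_, fun x => ?_⟩
  · rw [← hdot]
    simp
  · have := hb ⟨0, hq⟩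
    rw [← LinearMap.sq_singularValues_fin, hadj] at this
    exact congrArg WithLp.ofLp this
  · set X : EuclideanSpace ℝ (Fin q) := WithLp.toLp 2 x
    have h1 : (A *ᵥ x) ⬝ᵥ (A *ᵥ x) = inner ℝ (LinearMap.adjoint T (T X)) X := by
      rw [LinearMap.adjoint_inner_left, ← hdot']
      rfl
    rw [h1, ← hdot x x, ← b.sum_inner_mul_inner X X, ← b.sum_inner_mul_inner _ X, Finset.mul_sum]
    refine Finset.sum_le_sum fun i _ => ?_
    have h2 : inner ℝ (LinearMap.adjoint T (T X)) (b i) =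
        hS.eigenvalues hfr i * inner ℝ X (b i) := by
      rw [LinearMap.adjoint_inner_left, ← LinearMap.adjoint_inner_right, hb, inner_smul_right]
    rw [h2, hρ, mul_assoc, T.sq_singularValues_fin hfr ⟨0, hq⟩]
    gcongr
    · rw [real_inner_comm]
      exact mul_self_nonneg _
    · exact hS.eigenvalues_antitone hfr (Fin.mk_le_of_le_val (Nat.zero_le _))

lemma largestSingularValue_pos {p q : ℕ} {A : Matrix (Fin p) (Fin q) ℝ} (hA : A ≠ 0) :
    0 < DeepLinear.largestSingularValue A := by
  refine (LinearMap.singularValues_pos_iff_lt_finrank_range _).mpr ?_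
  rw [Nat.pos_iff_ne_zero, Ne, Submodule.finrank_eq_zero, LinearMap.range_eq_bot]
  simpa using hA

/-- A best approximation `P` of `R`, among a set of matrices closed under multiplication from both
sides and containing the rank-one matrices, agrees with `R` on a top singular vector of `R`. -/
lemma exists_top_singular_vector_of_best_approx {p q : ℕ} (hq : 0 < q)
    {R P : Matrix (Fin p) (Fin q) ℝ} (hR : R ≠ 0)
    (hmul : ∀ (A : Matrix (Fin p) (Fin p) ℝ) (B : Matrix (Fin q) (Fin q) ℝ),
      frobInner (R - P) (R - P) ≤ frobInner (R - A * P * B) (R - A * P * B))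
    (hone : ∀ (u : Fin p → ℝ) (v : Fin q → ℝ),
      frobInner (R - P) (R - P) ≤ frobInner (R - vecMulVec u v) (R - vecMulVec u v)) :
    ∃ v : Fin q → ℝ, v ⬝ᵥ v = 1 ∧ R *ᵥ v = P *ᵥ v ∧
      (P *ᵥ v) ⬝ᵥ (P *ᵥ v) = DeepLinear.largestSingularValue R ^ 2 := by
  set ρ := DeepLinear.largestSingularValue R
  have hρ : 0 < ρ := largestSingularValue_pos hR
  obtain ⟨v, hv1, hv, hmax⟩ := exists_top_singular_vector hq R
  set E := R - P with hE
  have hRPE : R = P + E := by simp [hE]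
  -- Stationarity of the error under `P ↦ P (1 + t Pᵀ E)`; the next step uses the mirror image on
  -- the left.
  have hPE : Pᵀ * E = 0 := by
    rw [← frobInner_self_eq_zero]
    refine eq_zero_of_forall_quadratic_nonneg (b := frobInner (P * (Pᵀ * E)) (P * (Pᵀ * E)))
      fun t => ?_
    have h := hmul 1 (1 + t • (Pᵀ * E))
    have h2 : R - (1 : Matrix (Fin p) (Fin p) ℝ) * P * (1 + t • (Pᵀ * E)) = E - t • (P * (Pᵀ * E)) := by
      rw [Matrix.one_mul, Matrix.mul_add, Matrix.mul_one, Matrix.mul_smul, hE]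
      abel
    rw [h2] at h
    simp only [frobInner_sub_left, frobInner_sub_right, frobInner_smul_left,
      frobInner_smul_right] at h
    rw [frobInner_comm (P * (Pᵀ * E)) E, frobInner_mul_left_eq E] at h
    nlinarith
  have hEP : E * Pᵀ = 0 := by
    rw [← frobInner_self_eq_zero]
    refine eq_zero_of_forall_quadratic_nonneg (b := frobInner (E * Pᵀ * P) (E * Pᵀ * P))
      fun t => ?_
    have h := hmul (1 + t • (E * Pᵀ)) 1
    have h2 : R - (1 + t • (E * Pᵀ)) * P * (1 : Matrix (Fin q) (Fin q) ℝ) = E - t • (E * Pᵀ * P) := by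
      rw [Matrix.mul_one, Matrix.add_mul, Matrix.one_mul, Matrix.smul_mul, hE]
      abel
    rw [h2] at h
    simp only [frobInner_sub_left, frobInner_sub_right, frobInner_smul_left,
      frobInner_smul_right] at h
    rw [frobInner_comm (E * Pᵀ * P) E, frobInner_mul_right_eq E] at h
    nlinarith
  have hEP' : Eᵀ * P = 0 := by simpa using congrArg transpose hPE
  have hPE' : P * Eᵀ = 0 := by simpa using congrArg transpose hEP
  have dot_mul : ∀ (A : Matrix (Fin p) (Fin q) ℝ) (x y : Fin q → ℝ),
      (A *ᵥ x) ⬝ᵥ (A *ᵥ y) = x ⬝ᵥ (Aᵀ *ᵥ (A *ᵥ y)) := by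
    intro A x y
    rw [Matrix.dotProduct_mulVec x, Matrix.vecMul_transpose]
  set w := Pᵀ *ᵥ (P *ᵥ v) with hw
  -- By orthogonality `RᵀR = PᵀP + EᵀE` with `P Eᵀ = 0`. If `w ≠ 0`, it is an eigenvector of `PᵀP`
  -- for `ρ²` killed by `E`, and normalizing it suffices. If `w = 0`, then `P` misses `v` entirely,
  -- and the top singular vector `b` of `P` takes its place.
  by_cases hw0 : w = 0
  · have hPv : P *ᵥ v = 0 := by
      rw [← dotProduct_self_eq_zero, dot_mul, ← hw, hw0, dotProduct_zero]
    have hEv : E *ᵥ v = R *ᵥ v := by rw [hE, sub_mulVec, hPv, sub_zero]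
    have huu : (R *ᵥ v) ⬝ᵥ (R *ᵥ v) = ρ ^ 2 := by
      rw [dot_mul, hv, dotProduct_smul, hv1]
      simp [ρ]
    by_cases hP : P = 0
    · exfalso
      have h := hone (R *ᵥ v) v
      have hER : E = R := by rw [hE, hP, sub_zero]
      rw [hER] at h
      simp only [frobInner_sub_left, frobInner_sub_right] at h
      rw [frobInner_comm (vecMulVec (R *ᵥ v) v) R] at h
      simp only [frobInner_vecMulVec, vecMulVec_mulVec, hv1, huu] at h
      simp [huu] at h
      nlinarith
    · obtain ⟨b, hb1, hb, -⟩ := exists_top_singular_vector hq P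
      set σ := DeepLinear.largestSingularValue P
      have hσ : 0 < σ := largestSingularValue_pos hP
      have haa : (P *ᵥ b) ⬝ᵥ (P *ᵥ b) = σ ^ 2 := by
        rw [dot_mul, hb, dotProduct_smul, hb1]
        simp
      have hEb : E *ᵥ b = 0 := by
        have h1 : E *ᵥ (σ ^ 2 • b) = 0 := by
          rw [← hb, mulVec_mulVec, hEP, zero_mulVec]
        rw [mulVec_smul] at h1
        exact (smul_eq_zero.mp h1).resolve_left (by positivity)
      have hRb : R *ᵥ b = P *ᵥ b := by rw [hRPE, add_mulVec, hEb, add_zero]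
      refine ⟨b, hb1, hRb, le_antisymm ?_ ?_⟩
      · have := hmax b
        rwa [hRb, hb1, mul_one] at this
      · set a := P *ᵥ b with ha
        set u := R *ᵥ v with hu
        have hbv : b ⬝ᵥ v = 0 := by
          have h1 : (σ ^ 2 • b) ⬝ᵥ v = 0 := by
            rw [← hb, dotProduct_comm, ← dot_mul, hPv, zero_dotProduct]
          rw [smul_dotProduct, smul_eq_mul] at h1
          exact (mul_eq_zero.mp h1).resolve_left (by positivity)
        -- The two factors turn `P` into `P - a bᵀ + u vᵀ`, trading a singular component of size `σ`
        -- for one of size `ρ`. The squared error changes by `σ² - ρ²`, so optimality gives `ρ ≤ σ`.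
        have h := hmul (1 + vecMulVec ((σ ^ 2)⁻¹ • (u - a)) a) (1 - vecMulVec b b + vecMulVec b v)
        have haP : a ᵥ* P = σ ^ 2 • b := by
          rw [← mulVec_transpose, hb]
        have hprod : R - (1 + vecMulVec ((σ ^ 2)⁻¹ • (u - a)) a) * P *
            (1 - vecMulVec b b + vecMulVec b v) = E + vecMulVec a b - vecMulVec u v := by
          rw [Matrix.add_mul, Matrix.one_mul, vecMulVec_mul, haP]
          have e1 : vecMulVec ((σ ^ 2)⁻¹ • (u - a)) (σ ^ 2 • b) = vecMulVec (u - a) b := by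
            ext i j
            simp only [vecMulVec_apply, Pi.smul_apply, smul_eq_mul]
            field_simp
          rw [e1]
          have e2 : (P + vecMulVec (u - a) b) * (1 - vecMulVec b b + vecMulVec b v) =
              P + vecMulVec (u - a) b - vecMulVec u b + vecMulVec u v := by
            have e3 : (P + vecMulVec (u - a) b) *ᵥ b = u := by
              rw [add_mulVec, vecMulVec_mulVec, hb1, ← ha]
              simp
            rw [Matrix.mul_add, Matrix.mul_sub, Matrix.mul_one, mul_vecMulVec, mul_vecMulVec, e3]
          rw [e2, sub_vecMulVec, hE]
          abel
        rw [hprod] at h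
        simp only [frobInner_sub_left, frobInner_sub_right, frobInner_add_left,
          frobInner_add_right] at h
        rw [frobInner_comm (vecMulVec a b) E, frobInner_comm (vecMulVec u v) E,
          frobInner_comm (vecMulVec u v) (vecMulVec a b)] at h
        have hvb : v ⬝ᵥ b = 0 := by rw [dotProduct_comm, hbv]
        simp only [frobInner_vecMulVec, vecMulVec_mulVec, hEb, hEv, hbv, hb1, hv1] at h
        simp only [dotProduct_zero, zero_smul, MulOpposite.op_zero, MulOpposite.op_one, one_smul,
          huu, haa] at h
        rw [haa]
        linarith
  · have hww : 0 < w ⬝ᵥ w := by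
      rcases (dotProduct_self_star_nonneg w).lt_or_eq with h | h
      · simpa using h
      · exact absurd (dotProduct_self_eq_zero.mp h.symm) hw0
    have hEw : E *ᵥ w = 0 := by rw [hw, mulVec_mulVec, hEP, zero_mulVec]
    have hPw : Pᵀ *ᵥ (P *ᵥ w) = ρ ^ 2 • w := by
      have h1 : Pᵀ *ᵥ (P *ᵥ (Rᵀ *ᵥ (R *ᵥ v))) = ρ ^ 2 • w := by
        rw [hv, mulVec_smul, mulVec_smul]
      have h2 : Rᵀ *ᵥ (R *ᵥ v) = w + Eᵀ *ᵥ (E *ᵥ v) := by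
        rw [hw]
        simp only [mulVec_mulVec]
        rw [← add_mulVec, hRPE, transpose_add, Matrix.add_mul, Matrix.mul_add, Matrix.mul_add,
          hPE, hEP']
        simp
      rw [h2, mulVec_add, mulVec_mulVec (N := Eᵀ), hPE', zero_mulVec, add_zero] at h1
      exact h1
    have hPww : (P *ᵥ w) ⬝ᵥ (P *ᵥ w) = ρ ^ 2 * (w ⬝ᵥ w) := by
      rw [dot_mul, hPw, dotProduct_smul, smul_eq_mul]
    set c := Real.sqrt (w ⬝ᵥ w) with hc
    have hc0 : 0 < c := Real.sqrt_pos.mpr hww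
    have hc2 : c * c = w ⬝ᵥ w := Real.mul_self_sqrt hww.le
    refine ⟨c⁻¹ • w, ?_, ?_, ?_⟩
    · rw [smul_dotProduct, dotProduct_smul, ← hc2, smul_eq_mul, smul_eq_mul]
      field_simp
    · rw [hRPE, add_mulVec, mulVec_smul E, hEw, smul_zero, add_zero]
    · rw [mulVec_smul, smul_dotProduct, dotProduct_smul, hPww, ← hc2, smul_eq_mul, smul_eq_mul]
      field_simp

/-! ### The loss as a function of the weights, and its forward and backward passes. -/

namespace DeepLinear

lemma loss_eq {L N : ℕ} {n : Fin (L + 1) → ℕ} (hn : 0 < n 0)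
    (R : Matrix (Fin (n (Fin.last L))) (Fin (n 0)) ℝ)
    {x : Fin N → EuclideanSpace ℝ (Fin (n 0))}
    (hx : (1 / (N : ℝ)) • ∑ i, Matrix.vecMulVec (x i) (x i) = 1) :
    loss R x = fun W => 1 / 2 * frobInner (R - endToEnd W) (R - endToEnd W) := by
  -- For `N = 0` the left side of `hx` is the zero matrix, which differs from `1` since `n 0` is
  -- positive.
  have hN : (N : ℝ) ≠ 0 := by
    intro h
    have := congrFun (congrFun hx ⟨0, hn⟩) ⟨0, hn⟩
    simp [h] at this
  have hsum : ∑ i, Matrix.vecMulVec (x i) (x i) = (N : ℝ) • (1 : Matrix (Fin (n 0)) (Fin (n 0)) ℝ) := by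
    rw [← hx, smul_smul, mul_one_div_cancel hN, one_smul]
  funext W
  set M := R - endToEnd W with hM
  have h1 : ∀ i, ‖R.toEuclideanLin (x i) - (endToEnd W).toEuclideanLin (x i)‖ ^ 2 =
      frobInner (Mᵀ * M) (vecMulVec (x i) (x i)) := by
    intro i
    rw [← LinearMap.sub_apply, ← map_sub, ← hM, frobInner_vecMulVec, ← mulVec_mulVec,
      dotProduct_mulVec, vecMul_transpose, EuclideanSpace.real_norm_sq_eq, dotProduct]
    exact Finset.sum_congr rfl fun a _ => by rw [pow_two]; rfl
  have h2 : ∑ i, frobInner (Mᵀ * M) (vecMulVec (x i) (x i)) =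
      frobInner (Mᵀ * M) (∑ i, vecMulVec (x i) (x i)) := by
    simp only [frobInner, Matrix.mul_sum, trace_sum]
  rw [loss, Finset.sum_congr rfl fun i _ => h1 i, h2, hsum, frobInner_smul_right]
  have h3 : frobInner (Mᵀ * M) 1 = frobInner M M := by
    simp [frobInner]
  rw [h3]
  field_simp

variable {L : ℕ} {n : Fin (L + 1) → ℕ}

lemma weight_add_smul (W Z : Params n) (t : ℝ) (j : Fin L) :
    weight (W + t • Z) j = weight W j + t • weight Z j := rfl

lemma partialProd_zero (W : Params n) : partialProd W 0 = 1 := rfl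

lemma partialProd_succ (W : Params n) (j : Fin L) :
    partialProd W j.succ = weight W j * partialProd W j.castSucc :=
  Fin.induction_succ _ _ _

/-- The point of the parameter space with given weight matrices. -/
def ofWeights (w : ∀ j : Fin L, Matrix (Fin (n j.succ)) (Fin (n j.castSucc)) ℝ) : Params n :=
  WithLp.toLp 2 fun i => w i.1 i.2.1 i.2.2

@[simp]
lemma weight_ofWeights (w : ∀ j : Fin L, Matrix (Fin (n j.succ)) (Fin (n j.castSucc)) ℝ)
    (j : Fin L) : weight (ofWeights w) j = w j := rfl

lemma inner_eq_sum_frobInner (V Z : Params n) :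
    inner ℝ V Z = ∑ j, frobInner (weight V j) (weight Z j) := by
  rw [PiLp.inner_apply, Fintype.sum_sigma]
  refine Finset.sum_congr rfl fun j _ => ?_
  rw [frobInner_eq_sum, Fintype.sum_prod_type]
  refine Finset.sum_congr rfl fun a _ => Finset.sum_congr rfl fun b _ => ?_
  simp [weight, mul_comm]

lemma contDiff_partialProd (k : Fin (L + 1)) (a : Fin (n k)) (b : Fin (n 0)) :
    ContDiff ℝ ω fun W : Params n => partialProd W k a b := by
  induction k using Fin.induction with
  | zero => exact contDiff_const
  | succ j ih =>
    simp_rw [partialProd_succ, mul_apply]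
    refine ContDiff.sum fun c _ => ContDiff.mul ?_ (ih c)
    exact contDiff_piLp_apply (𝕜 := ℝ) (p := 2)
      (E := fun _ : Σ j : Fin L, Fin (n j.succ) × Fin (n j.castSucc) => ℝ) (i := ⟨j, (a, c)⟩)

lemma contDiff_loss (R : Matrix (Fin (n (Fin.last L))) (Fin (n 0)) ℝ) :
    ContDiff ℝ ω fun W : Params n => 1 / 2 * frobInner (R - endToEnd W) (R - endToEnd W) := by
  simp_rw [frobInner_eq_sum, Matrix.sub_apply]
  refine contDiff_const.mul (ContDiff.sum fun a _ => ContDiff.sum fun b _ => ?_)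
  have h : ContDiff ℝ ω fun W : Params n => R a b - endToEnd W a b :=
    contDiff_const.sub (contDiff_partialProd _ a b)
  exact h.mul h

lemma hasDerivAt_mulVec {p q : ℕ} (A : Matrix (Fin p) (Fin q) ℝ) {h : ℝ → Fin q → ℝ}
    {d : Fin q → ℝ} {t : ℝ} (hh : HasDerivAt h d t) :
    HasDerivAt (fun s => A *ᵥ h s) (A *ᵥ d) t :=
  ((mulVecLin A).toContinuousLinearMap.hasFDerivAt (x := h t)).comp_hasDerivAt t hh

lemma hasDerivAt_dotProduct {p : ℕ} {f g : ℝ → Fin p → ℝ} {f' g' : Fin p → ℝ} {t : ℝ}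
    (hf : HasDerivAt f f' t) (hg : HasDerivAt g g' t) :
    HasDerivAt (fun s => f s ⬝ᵥ g s) (f' ⬝ᵥ g t + f t ⬝ᵥ g') t := by
  rw [hasDerivAt_pi] at hf hg
  simp only [dotProduct, ← Finset.sum_add_distrib]
  exact HasDerivAt.fun_sum fun i _ => (hf i).mul (hg i)

/-- Derivative of the forward pass on the input `v`, paired with a backward pass `q`. -/
lemma exists_hasDerivAt_partialProd_mulVec (W Z : Params n) (v : Fin (n 0) → ℝ)
    (q : ∀ k : Fin (L + 1), Fin (n k) → ℝ)
    (hq : ∀ j : Fin L, q j.castSucc = (weight W j)ᵀ *ᵥ q j.succ) (k : Fin (L + 1)) :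
    ∃ d : Fin (n k) → ℝ, HasDerivAt (fun s : ℝ => partialProd (W + s • Z) k *ᵥ v) d 0 ∧
      q k ⬝ᵥ d = ∑ j : Fin L with j.castSucc < k,
        q j.succ ⬝ᵥ weight Z j *ᵥ partialProd W j.castSucc *ᵥ v := by
  induction k using Fin.induction with
  | zero => exact ⟨0, by simpa [partialProd_zero] using hasDerivAt_const _ _, by simp⟩
  | succ i ih =>
    obtain ⟨d, hd, hqd⟩ := ih
    refine ⟨weight W i *ᵥ d + weight Z i *ᵥ partialProd W i.castSucc *ᵥ v, ?_, ?_⟩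
    · have h1 : (fun s : ℝ => partialProd (W + s • Z) i.succ *ᵥ v) = fun s =>
          weight W i *ᵥ partialProd (W + s • Z) i.castSucc *ᵥ v +
            s • weight Z i *ᵥ partialProd (W + s • Z) i.castSucc *ᵥ v := by
        funext s
        rw [partialProd_succ, weight_add_smul, ← mulVec_mulVec, add_mulVec, smul_mulVec]
      rw [h1]
      have h2 := (hasDerivAt_id (0 : ℝ)).smul (hasDerivAt_mulVec (weight Z i) hd)
      have h3 := (hasDerivAt_mulVec (weight W i) hd).add h2
      rw [id, zero_smul, zero_add, one_smul, zero_smul, add_zero] at h3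
      exact h3
    · have h1 : (Finset.univ.filter fun j : Fin L => j.castSucc < i.succ) =
          insert i (Finset.univ.filter fun j : Fin L => j.castSucc < i.castSucc) := by
        ext j
        simp [le_iff_eq_or_lt]
      rw [h1, Finset.sum_insert (by simp), ← hqd, dotProduct_add, hq, dotProduct_mulVec,
        ← mulVec_transpose, add_comm]

/-- Backpropagation: `q k` is `(W_L ⋯ W_{k+1})ᵀ u`. -/
lemma exists_backward_pass (W : Params n) (u : Fin (n (Fin.last L)) → ℝ) :
    ∃ q : ∀ k : Fin (L + 1), Fin (n k) → ℝ, q (Fin.last L) = u ∧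
      ∀ j : Fin L, q j.castSucc = (weight W j)ᵀ *ᵥ q j.succ :=
  ⟨fun k => Fin.reverseInduction (motive := fun k => Fin (n k) → ℝ) u
      (fun j y => (weight W j)ᵀ *ᵥ y) k,
    Fin.reverseInduction_last, fun _ => Fin.reverseInduction_castSucc _⟩

lemma backward_dotProduct_forward (W : Params n) (v : Fin (n 0) → ℝ)
    (q : ∀ k : Fin (L + 1), Fin (n k) → ℝ)
    (hq : ∀ j : Fin L, q j.castSucc = (weight W j)ᵀ *ᵥ q j.succ) (k : Fin (L + 1)) :
    q k ⬝ᵥ partialProd W k *ᵥ v = q (Fin.last L) ⬝ᵥ endToEnd W *ᵥ v := by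
  induction k using Fin.reverseInduction with
  | last => rfl
  | cast j ih =>
    rw [← ih, partialProd_succ, ← mulVec_mulVec, dotProduct_mulVec (q j.succ), hq,
      mulVec_transpose]

/-! ### Which end-to-end matrices are reachable. -/

section Succ

variable {m : ℕ} {n : Fin (m + 1 + 1) → ℕ}

/-- The first weight matrix, with `n 0` columns on the nose. -/
def firstWeight (W : Params n) : Matrix (Fin (n (Fin.succ 0))) (Fin (n 0)) ℝ := weight W 0

/-- The last weight matrix, with `n (Fin.last (m + 1))` rows on the nose. -/
def lastWeight (W : Params n) :
    Matrix (Fin (n (Fin.last (m + 1)))) (Fin (n (Fin.last m).castSucc)) ℝ := weight W (Fin.last m)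

lemma partialProd_succ_zero (W : Params n) : partialProd W (Fin.succ 0) = firstWeight W :=
  Matrix.mul_one (firstWeight W)

lemma endToEnd_eq_lastWeight_mul (W : Params n) :
    endToEnd W = lastWeight W * partialProd W (Fin.last m).castSucc := rfl

/-- Replace the first weight matrix. -/
def setFirstWeight (W : Params n) (M : Matrix (Fin (n (Fin.succ 0))) (Fin (n 0)) ℝ) : Params n :=
  ofWeights (Function.update (weight W) 0 M)

lemma firstWeight_setFirstWeight (W : Params n)
    (M : Matrix (Fin (n (Fin.succ 0))) (Fin (n 0)) ℝ) :
    firstWeight (setFirstWeight W M) = M :=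
  Function.update_self (0 : Fin (m + 1)) _ (weight W)

lemma weight_succ_setFirstWeight (W : Params n)
    (M : Matrix (Fin (n (Fin.succ 0))) (Fin (n 0)) ℝ) (j : Fin m) :
    weight (setFirstWeight W M) j.succ = weight W j.succ :=
  Function.update_of_ne (Fin.succ_ne_zero j) M (weight W)

lemma partialProd_succ_of_weight_zero_eq {W W' : Params n}
    {Q : Matrix (Fin (n 0)) (Fin (n 0)) ℝ}
    (h0 : firstWeight W' = firstWeight W * Q)
    (h : ∀ j : Fin m, weight W' j.succ = weight W j.succ) (k : Fin (m + 1)) :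
    partialProd W' k.succ = partialProd W k.succ * Q := by
  induction k using Fin.induction with
  | zero =>
    rw [partialProd_succ_zero, partialProd_succ_zero]
    exact h0
  | succ i ih =>
    rw [partialProd_succ, partialProd_succ, h, Matrix.mul_assoc]
    exact congrArg _ ih

lemma exists_endToEnd_eq_mul_right (W : Params n) (Q : Matrix (Fin (n 0)) (Fin (n 0)) ℝ) :
    ∃ W' : Params n, endToEnd W' = endToEnd W * Q := by
  refine ⟨setFirstWeight W (firstWeight W * Q), ?_⟩
  exact partialProd_succ_of_weight_zero_eq (firstWeight_setFirstWeight _ _)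
    (weight_succ_setFirstWeight _ _) (Fin.last m)

lemma exists_endToEnd_eq_mul_left (W : Params n)
    (Q : Matrix (Fin (n (Fin.last (m + 1)))) (Fin (n (Fin.last (m + 1)))) ℝ) :
    ∃ W' : Params n, endToEnd W' = Q * endToEnd W := by
  set W' := ofWeights (Function.update (weight W) (Fin.last m)
    (Q * lastWeight W))
  have h : ∀ k : Fin (m + 1), partialProd W' k.castSucc = partialProd W k.castSucc := by
    intro k
    induction k using Fin.induction with
    | zero => rfl
    | succ i ih =>
      have hi : weight W' i.castSucc = weight W i.castSucc := by
        rw [weight_ofWeights, Function.update_of_ne (Fin.castSucc_lt_last i).ne]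
      have h1 := partialProd_succ W' i.castSucc
      rw [ih, hi, ← partialProd_succ] at h1
      exact h1
  refine ⟨W', ?_⟩
  have h1 : lastWeight W' = Q * lastWeight W := by
    change weight W' (Fin.last m) = _
    rw [weight_ofWeights, Function.update_self]
  rw [endToEnd_eq_lastWeight_mul, endToEnd_eq_lastWeight_mul, h, h1, Matrix.mul_assoc]

lemma exists_endToEnd_eq_mul_mul (W : Params n)
    (A : Matrix (Fin (n (Fin.last (m + 1)))) (Fin (n (Fin.last (m + 1)))) ℝ)
    (B : Matrix (Fin (n 0)) (Fin (n 0)) ℝ) :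
    ∃ W' : Params n, endToEnd W' = A * endToEnd W * B := by
  obtain ⟨W₁, h₁⟩ := exists_endToEnd_eq_mul_left W A
  obtain ⟨W₂, h₂⟩ := exists_endToEnd_eq_mul_right W₁ B
  exact ⟨W₂, by rw [h₂, h₁]⟩

/-- With all weights equal to one the product has positive entries, as no layer is empty; one
nonzero entry can be isolated and reshaped by multiplying on both sides. -/
lemma exists_endToEnd_eq_vecMulVec (hn : ∀ j, 1 ≤ n j) (u : Fin (n (Fin.last (m + 1))) → ℝ)
    (v : Fin (n 0) → ℝ) : ∃ W : Params n, endToEnd W = vecMulVec u v := by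
  set W : Params n := ofWeights fun j => Matrix.of fun _ _ => 1 with hW
  have hpos : ∀ (k : Fin (m + 1)) (a : Fin (n k.succ)) (b : Fin (n 0)),
      0 < partialProd W k.succ a b := by
    intro k
    induction k using Fin.induction with
    | zero =>
      intro a b
      rw [partialProd_succ_zero]
      exact one_pos
    | succ i ih =>
      intro a b
      rw [partialProd_succ, mul_apply]
      refine Finset.sum_pos (fun c _ => mul_pos one_pos (ih c b)) ⟨⟨0, hn _⟩, Finset.mem_univ _⟩
  set a₀ : Fin (n (Fin.last (m + 1))) := ⟨0, hn _⟩
  set b₀ : Fin (n 0) := ⟨0, hn _⟩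
  have hne : endToEnd W a₀ b₀ ≠ 0 := (hpos (Fin.last m) a₀ b₀).ne'
  obtain ⟨W', hW'⟩ := exists_endToEnd_eq_mul_mul W (vecMulVec u (Pi.single a₀ 1))
    ((endToEnd W a₀ b₀)⁻¹ • vecMulVec (Pi.single b₀ 1) v)
  refine ⟨W', ?_⟩
  rw [hW', vecMulVec_mul, Matrix.mul_smul, vecMulVec_mul_vecMulVec]
  ext i j
  simp [vecMulVec_apply]
  field_simp

end Succ

end DeepLinear

/-! ### Curvature at a global optimum. -/

namespace DeepLinear

/-- AM-GM: regrouped by index, the product of the summands is `α_L β_0 ∏ α_k β_k` over the interior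
`k`, at least `ρ² ρ^(4m)`; its `(m+1)`-th root is `ρ² ρ^(2m/(m+1))`. -/
lemma prod_le_sum_of_le_mul (m : ℕ) {ρ : ℝ} (hρ : 0 < ρ) {α β : Fin (m + 1 + 1) → ℝ}
    (hα : ∀ k, 0 ≤ α k) (hβ : ∀ k, 0 ≤ β k) (h : ∀ k, ρ ^ 4 ≤ α k * β k)
    (hlast : α (Fin.last (m + 1)) = ρ ^ 2) (hzero : β 0 = 1) :
    ((m : ℝ) + 1) * ρ ^ 2 * ρ ^ (2 * (m : ℝ) / ((m : ℝ) + 1)) ≤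
      ∑ j : Fin (m + 1), α j.succ * β j.castSucc := by
  have hm : (0 : ℝ) < (m : ℝ) + 1 := by positivity
  have hprod : ρ ^ (4 * m + 2) ≤ ∏ j : Fin (m + 1), α j.succ * β j.castSucc := by
    rw [Finset.prod_mul_distrib, Fin.prod_univ_castSucc (fun j : Fin (m + 1) => α j.succ),
      Fin.prod_univ_succ (fun j : Fin (m + 1) => β j.castSucc), Fin.succ_last, hlast,
      Fin.castSucc_zero, hzero, one_mul, mul_right_comm, ← Finset.prod_mul_distrib, pow_add, pow_mul]
    gcongr
    calc (ρ ^ 4) ^ m = ∏ _i : Fin m, ρ ^ 4 := by simp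
      _ ≤ _ := Finset.prod_le_prod (fun _ _ => by positivity) fun i _ => h _
  have hamgm := Real.geom_mean_le_arith_mean_weighted Finset.univ
    (fun _ : Fin (m + 1) => ((m : ℝ) + 1)⁻¹) (fun j => α j.succ * β j.castSucc)
    (fun _ _ => by positivity) (by simp; field_simp) (fun j _ => mul_nonneg (hα _) (hβ _))
  rw [Real.finsetProd_rpow _ _ (fun j _ => mul_nonneg (hα _) (hβ _)), ← Finset.mul_sum,
    le_inv_mul_iff₀ hm] at hamgm
  refine le_trans ?_ hamgm
  rw [mul_assoc]
  gcongr
  calc ρ ^ 2 * ρ ^ (2 * (m : ℝ) / ((m : ℝ) + 1)) = (ρ ^ (4 * m + 2)) ^ ((m : ℝ) + 1)⁻¹ := by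
        rw [← Real.rpow_natCast, ← Real.rpow_natCast, ← Real.rpow_mul hρ.le, ← Real.rpow_add hρ]
        congr 1
        push_cast
        field_simp
        ring
    _ ≤ _ := by gcongr

lemma sq_dotProduct_le {p : ℕ} (x y : Fin p → ℝ) : (x ⬝ᵥ y) ^ 2 ≤ (x ⬝ᵥ x) * (y ⬝ᵥ y) := by
  simpa [dotProduct, ← pow_two] using Finset.sum_mul_sq_le_sq_mul_sq Finset.univ x y

lemma dotProduct_self_nonneg' {p : ℕ} (x : Fin p → ℝ) : 0 ≤ x ⬝ᵥ x :=
  Finset.sum_nonneg fun _ _ => mul_self_nonneg _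

variable {m : ℕ} {n : Fin (m + 1 + 1) → ℕ}

/-- Perturbation of the first weight matrix realizing right multiplication of the end-to-end
matrix by `1 + t vvᵀ`. -/
def rankOneScaling (v : Fin (n 0) → ℝ) (W : Params n) : Params n :=
  setFirstWeight 0 (firstWeight W * vecMulVec v v)

lemma rankOneScaling_add_smul (v : Fin (n 0) → ℝ) (W Z : Params n) (t : ℝ) :
    rankOneScaling v (W + t • Z) = rankOneScaling v W + t • rankOneScaling v Z := by
  have h : ∀ A B : Params n, (∀ j, weight A j = weight B j) → A = B := by
    intro A B hAB
    ext ⟨j, a, b⟩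
    exact congrFun (congrFun (hAB j) a) b
  refine h _ _ fun j => ?_
  rw [weight_add_smul]
  refine Fin.cases ?_ (fun j => ?_) j
  · change firstWeight _ = firstWeight (rankOneScaling v W) + t • firstWeight (rankOneScaling v Z)
    simp only [rankOneScaling, firstWeight_setFirstWeight]
    rw [← Matrix.smul_mul, ← Matrix.add_mul]
    rfl
  · simp only [rankOneScaling, weight_succ_setFirstWeight]
    change 0 = 0 + t • 0
    simp

lemma endToEnd_add_smul_rankOneScaling (v : Fin (n 0) → ℝ) (W : Params n) (t : ℝ) :
    endToEnd (W + t • rankOneScaling v W) =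
      endToEnd W + t • vecMulVec (endToEnd W *ᵥ v) v := by
  have h : endToEnd (W + t • rankOneScaling v W) = endToEnd W * (1 + t • vecMulVec v v) := by
    refine partialProd_succ_of_weight_zero_eq ?_ (fun j => ?_) (Fin.last m)
    · change firstWeight W + t • firstWeight (rankOneScaling v W) = _
      rw [rankOneScaling, firstWeight_setFirstWeight, Matrix.mul_add, Matrix.mul_one,
        Matrix.mul_smul]
    · rw [weight_add_smul, rankOneScaling, weight_succ_setFirstWeight]
      change _ + t • 0 = _
      simp
  rw [h, Matrix.mul_add, Matrix.mul_one, Matrix.mul_smul, mul_vecMulVec]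

/-- At a global optimum some curvature is at least `L ρ(R)^(2(L-1)/L)`. -/
lemma exists_curvature_ge (hn : ∀ j, 1 ≤ n j)
    {R : Matrix (Fin (n (Fin.last (m + 1)))) (Fin (n 0)) ℝ} (hR : R ≠ 0) {F : Params n → ℝ}
    (hF : F = fun W => 1 / 2 * frobInner (R - endToEnd W) (R - endToEnd W)) {W : Params n}
    (hW : ∀ V, F W ≤ F V) :
    ∃ V : Params n, V ≠ 0 ∧
      ((m : ℝ) + 1) * largestSingularValue R ^ (2 * (m : ℝ) / ((m : ℝ) + 1)) * ‖V‖ ^ 2 ≤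
        fderiv ℝ (fderiv ℝ F) W V V := by
  set ρ := largestSingularValue R
  have hρ : 0 < ρ := largestSingularValue_pos hR
  have hcd : ContDiff ℝ ω F := hF ▸ contDiff_loss R
  have hmin : ∀ V : Params n, frobInner (R - endToEnd W) (R - endToEnd W) ≤
      frobInner (R - endToEnd V) (R - endToEnd V) := by
    intro V
    have := hW V
    simp only [hF] at this
    linarith
  obtain ⟨v, hv1, hRv, hPv⟩ := exists_top_singular_vector_of_best_approx (hn 0) hR
    (P := endToEnd W)
    (fun A B => by
      obtain ⟨W', hW'⟩ := exists_endToEnd_eq_mul_mul W A B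
      rw [← hW']
      exact hmin W')
    (fun u v => by
      obtain ⟨W', hW'⟩ := exists_endToEnd_eq_vecMulVec hn u v
      rw [← hW']
      exact hmin W')
  change _ = ρ ^ 2 at hPv
  obtain ⟨q, hqlast, hq⟩ := exists_backward_pass W (endToEnd W *ᵥ v)
  set V : Params n := ofWeights fun j =>
    vecMulVec (q j.succ) (partialProd W j.castSucc *ᵥ v) with hV
  have hqp : ∀ k, q k ⬝ᵥ partialProd W k *ᵥ v = ρ ^ 2 := by
    intro k
    rw [backward_dotProduct_forward W v q hq k, hqlast, hPv]
  have hVZ : ∀ Z, inner ℝ V Z =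
      ∑ j, q j.succ ⬝ᵥ weight Z j *ᵥ partialProd W j.castSucc *ᵥ v := by
    intro Z
    rw [inner_eq_sum_frobInner]
    refine Finset.sum_congr rfl fun j _ => ?_
    rw [hV, weight_ofWeights, frobInner_comm, frobInner_vecMulVec]
  have hnorm : ‖V‖ ^ 2 = ∑ j : Fin (m + 1), (q j.succ ⬝ᵥ q j.succ) *
      ((partialProd W j.castSucc *ᵥ v) ⬝ᵥ (partialProd W j.castSucc *ᵥ v)) := by
    rw [← real_inner_self_eq_norm_sq, hVZ]
    refine Finset.sum_congr rfl fun j _ => ?_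
    rw [hV, weight_ofWeights, vecMulVec_mulVec, dotProduct_smul]
    simp
  have hsum : ((m : ℝ) + 1) * ρ ^ 2 * ρ ^ (2 * (m : ℝ) / ((m : ℝ) + 1)) ≤ ‖V‖ ^ 2 := by
    rw [hnorm]
    refine prod_le_sum_of_le_mul m hρ (α := fun k => q k ⬝ᵥ q k)
      (β := fun k => (partialProd W k *ᵥ v) ⬝ᵥ (partialProd W k *ᵥ v))
      (fun k => dotProduct_self_nonneg' _) (fun k => dotProduct_self_nonneg' _) (fun k => ?_) ?_ ?_
    · have h1 := sq_dotProduct_le (q k) (partialProd W k *ᵥ v)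
      rw [hqp, ← pow_mul] at h1
      exact h1
    · rw [hqlast, hPv]
    · change ((1 : Matrix (Fin (n 0)) (Fin (n 0)) ℝ) *ᵥ v) ⬝ᵥ
        ((1 : Matrix (Fin (n 0)) (Fin (n 0)) ℝ) *ᵥ v) = 1
      rw [one_mulVec, hv1]
  -- This identity holds at every `W'`, not only at the optimum, so it may be differentiated in `W'`
  -- to reach the Hessian.
  have hdir : ∀ W' : Params n, fderiv ℝ F W' (rankOneScaling v W') =
      -((R *ᵥ v - endToEnd W' *ᵥ v) ⬝ᵥ (endToEnd W' *ᵥ v)) := by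
    intro W'
    have h1 := hasDerivAt_along hcd W' (rankOneScaling v W') 0
    rw [zero_smul, add_zero] at h1
    set E' := R - endToEnd W' with hE'
    set X := vecMulVec (endToEnd W' *ᵥ v) v with hX
    have h2 : (fun t : ℝ => F (W' + t • rankOneScaling v W')) = fun t : ℝ =>
        1 / 2 * frobInner E' E' - t * frobInner E' X + t ^ 2 * (1 / 2 * frobInner X X) := by
      funext t
      simp only [hF]
      rw [endToEnd_add_smul_rankOneScaling, ← sub_sub, ← hE', ← hX]
      simp only [frobInner_sub_left, frobInner_sub_right, frobInner_smul_left,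
        frobInner_smul_right]
      rw [frobInner_comm X E']
      ring
    have h3 : HasDerivAt (fun t : ℝ => 1 / 2 * frobInner E' E' - t * frobInner E' X +
        t ^ 2 * (1 / 2 * frobInner X X)) (-frobInner E' X) 0 := by
      have := (((hasDerivAt_id (0 : ℝ)).mul_const (frobInner E' X)).const_sub
        (1 / 2 * frobInner E' E')).add
        (((hasDerivAt_id (0 : ℝ)).pow 2).mul_const (1 / 2 * frobInner X X))
      exact this.congr_deriv (by simp)
    rw [h2] at h1
    rw [h1.unique h3, hX, frobInner_vecMulVec, dotProduct_comm, hE', sub_mulVec]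
  -- Differentiating `hdir` along `Z`: the term from the moving direction vanishes because the
  -- gradient is zero at `W`, and the residual term vanishes because `R v = P v`.
  have hHess : ∀ Z, fderiv ℝ (fderiv ℝ F) W Z (rankOneScaling v W) = inner ℝ V Z := by
    intro Z
    obtain ⟨d, hd, hqd⟩ := exists_hasDerivAt_partialProd_mulVec W Z v q hq (Fin.last (m + 1))
    have hall : (Finset.univ.filter fun j : Fin (m + 1) => j.castSucc < Fin.last (m + 1)) =
        Finset.univ := by
      ext j
      simp [Fin.castSucc_lt_last]
    rw [hall, ← hVZ, hqlast] at hqd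
    have h1 : HasDerivAt (fun s : ℝ => fderiv ℝ F (W + s • Z) (rankOneScaling v (W + s • Z)))
        (fderiv ℝ (fderiv ℝ F) W Z (rankOneScaling v W)) 0 := by
      have e : (fun s : ℝ => fderiv ℝ F (W + s • Z) (rankOneScaling v (W + s • Z))) =
          fun s => fderiv ℝ F (W + s • Z) (rankOneScaling v W) +
            s * fderiv ℝ F (W + s • Z) (rankOneScaling v Z) := by
        funext s
        rw [rankOneScaling_add_smul, map_add, map_smul, smul_eq_mul]
      rw [e]
      have := (hasDerivAt_fderiv_along hcd W Z (rankOneScaling v W) 0).add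
        ((hasDerivAt_id (0 : ℝ)).mul (hasDerivAt_fderiv_along hcd W Z (rankOneScaling v Z) 0))
      rw [zero_smul, add_zero, id, zero_mul, fderiv_eq_zero_of_forall_le hW] at this
      exact this.congr_deriv (by simp)
    have h2 : HasDerivAt (fun s : ℝ => fderiv ℝ F (W + s • Z) (rankOneScaling v (W + s • Z)))
        (inner ℝ V Z) 0 := by
      simp only [hdir]
      have h3 := (hasDerivAt_dotProduct (hd.const_sub (R *ᵥ v)) hd).neg
      rw [zero_smul, add_zero] at h3
      refine h3.congr_deriv ?_
      change -(-d ⬝ᵥ endToEnd W *ᵥ v + (R *ᵥ v - endToEnd W *ᵥ v) ⬝ᵥ d) = _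
      rw [hRv, sub_self, zero_dotProduct, add_zero, neg_dotProduct, neg_neg, dotProduct_comm,
        hqd]
    exact h1.unique h2
  have hVY : inner ℝ V (rankOneScaling v W) = ρ ^ 2 := by
    rw [hVZ, Fin.sum_univ_succ, Finset.sum_eq_zero, add_zero]
    · change q (Fin.succ 0) ⬝ᵥ firstWeight (rankOneScaling v W) *ᵥ
        (1 : Matrix (Fin (n 0)) (Fin (n 0)) ℝ) *ᵥ v = _
      rw [rankOneScaling, firstWeight_setFirstWeight, one_mulVec, mul_vecMulVec, vecMulVec_mulVec,
        hv1, MulOpposite.op_one, one_smul, ← hqp (Fin.succ 0), partialProd_succ_zero]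
    · intro j _
      rw [rankOneScaling, weight_succ_setFirstWeight]
      change _ ⬝ᵥ (0 : Matrix _ _ ℝ) *ᵥ _ = 0
      rw [zero_mulVec, dotProduct_zero]
  have hfour := norm_pow_four_le_curvature hcd hW (v := V) (y := rankOneScaling v W)
    (by rw [hVY]; positivity) hHess
  rw [hVY] at hfour
  refine ⟨V, ?_, ?_⟩
  · rintro h0
    rw [h0, norm_zero] at hsum
    have : 0 < ((m : ℝ) + 1) * ρ ^ 2 * ρ ^ (2 * (m : ℝ) / ((m : ℝ) + 1)) := by positivity
    simp at hsum
    linarith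
  · refine le_of_mul_le_mul_right ?_ (show 0 < ρ ^ 2 by positivity)
    refine le_trans ?_ hfour
    have := mul_le_mul_of_nonneg_right hsum (sq_nonneg ‖V‖)
    nlinarith

end DeepLinear

/-! ### A point where the derivative of the descent map is injective. -/

namespace DeepLinear

lemma hasDerivAt_quartic_zero (c₀ c₁ c₂ c₃ c₄ : ℝ) :
    HasDerivAt (fun t : ℝ => c₀ + t * c₁ + t ^ 2 * c₂ + t ^ 3 * c₃ + t ^ 4 * c₄) c₁ 0 := by
  have h := (((((hasDerivAt_id (0 : ℝ)).mul_const c₁).const_add c₀).add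
    (((hasDerivAt_id (0 : ℝ)).pow 2).mul_const c₂)).add
    (((hasDerivAt_id (0 : ℝ)).pow 3).mul_const c₃)).add
    (((hasDerivAt_id (0 : ℝ)).pow 4).mul_const c₄)
  exact h.congr_deriv (by simp)

lemma exists_mul_transpose_eq_smul_one {p q : ℕ} (hpq : p ≤ q) {c : ℝ} (hc : 0 ≤ c) :
    ∃ A : Matrix (Fin p) (Fin q) ℝ, A * Aᵀ = c • (1 : Matrix (Fin p) (Fin p) ℝ) := by
  refine ⟨Matrix.of fun a b => if b = Fin.castLE hpq a then √c else 0, ?_⟩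
  ext a b
  simp [mul_apply, Matrix.one_apply, hc, eq_comm]

section TwoLayer

variable {E : Type*} [NormedAddCommGroup E] [InnerProductSpace ℝ E] {p₀ p₁ p₂ : ℕ}
  {F : E → ℝ} {A : E → Matrix (Fin p₁) (Fin p₀) ℝ} {B : E → Matrix (Fin p₂) (Fin p₁) ℝ}
  {R : Matrix (Fin p₂) (Fin p₀) ℝ}

lemma second_fderiv_two_layer (hF : ContDiff ℝ ω F)
    (hFeq : F = fun W => 1 / 2 * frobInner (R - B W * A W) (R - B W * A W))
    (hA : ∀ W Z (t : ℝ), A (W + t • Z) = A W + t • A Z)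
    (hB : ∀ W Z (t : ℝ), B (W + t • Z) = B W + t • B Z) (W Z X : E) :
    fderiv ℝ (fderiv ℝ F) W Z X =
      frobInner (B Z * A W + B W * A Z) (B X * A W + B W * A X) -
        frobInner (R - B W * A W) (B X * A Z + B Z * A X) := by
  have h1 : ∀ W', fderiv ℝ F W' X =
      -frobInner (R - B W' * A W') (B X * A W' + B W' * A X) := by
    intro W'
    have h := hasDerivAt_along hF W' X 0
    rw [zero_smul, add_zero] at h
    set D := R - B W' * A W' with hD
    set K := B X * A W' + B W' * A X with hK
    set M := B X * A X with hM
    have e : (fun t : ℝ => F (W' + t • X)) = fun t =>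
        1 / 2 * frobInner D D + t * (-frobInner D K) +
          t ^ 2 * (1 / 2 * frobInner K K - frobInner D M) + t ^ 3 * frobInner K M +
          t ^ 4 * (1 / 2 * frobInner M M) := by
      funext t
      have e1 : R - B (W' + t • X) * A (W' + t • X) = D - t • K - (t ^ 2) • M := by
        rw [hA, hB, hD, hK, hM]
        simp only [Matrix.add_mul, Matrix.mul_add, Matrix.smul_mul, Matrix.mul_smul, smul_add,
          smul_smul, ← pow_two]
        abel
      simp only [hFeq]
      rw [e1]
      simp only [frobInner_sub_left, frobInner_sub_right, frobInner_smul_left,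
        frobInner_smul_right]
      rw [frobInner_comm K D, frobInner_comm M D, frobInner_comm M K]
      ring
    rw [e] at h
    exact h.unique (hasDerivAt_quartic_zero _ _ _ _ _)
  have h := hasDerivAt_fderiv_along hF W Z X 0
  rw [zero_smul, add_zero] at h
  simp only [h1] at h
  set D := R - B W * A W with hD
  set M := B Z * A W + B W * A Z with hM
  set N := B Z * A Z with hN
  set K := B X * A W + B W * A X with hK
  set K' := B X * A Z + B Z * A X with hK'
  have e : (fun t : ℝ => -frobInner (R - B (W + t • Z) * A (W + t • Z))
      (B X * A (W + t • Z) + B (W + t • Z) * A X)) = fun t =>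
      -frobInner D K + t * (frobInner M K - frobInner D K') +
        t ^ 2 * (frobInner N K + frobInner M K') + t ^ 3 * frobInner N K' + t ^ 4 * 0 := by
    funext t
    have e1 : R - B (W + t • Z) * A (W + t • Z) = D - t • M - (t ^ 2) • N := by
      rw [hA, hB, hD, hM, hN]
      simp only [Matrix.add_mul, Matrix.mul_add, Matrix.smul_mul, Matrix.mul_smul, smul_add,
        smul_smul, ← pow_two]
      abel
    have e2 : B X * A (W + t • Z) + B (W + t • Z) * A X = K + t • K' := by
      rw [hA, hB, hK, hK']
      simp only [Matrix.add_mul, Matrix.mul_add, Matrix.smul_mul, Matrix.mul_smul, smul_add]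
      abel
    simp only [e1, e2, frobInner_sub_left, frobInner_add_right, frobInner_smul_left,
      frobInner_smul_right]
    ring
  rw [e] at h
  exact h.unique (hasDerivAt_quartic_zero _ _ _ _ _)

lemma exists_regular_point_two_layer (hF : ContDiff ℝ ω F)
    (hFeq : F = fun W => 1 / 2 * frobInner (R - B W * A W) (R - B W * A W))
    (hA : ∀ W Z (t : ℝ), A (W + t • Z) = A W + t • A Z)
    (hB : ∀ W Z (t : ℝ), B (W + t • Z) = B W + t • B Z)
    (hinner : ∀ Z X, inner ℝ Z X = frobInner (A Z) (A X) + frobInner (B Z) (B X))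
    (hsurj : ∀ M N, ∃ W, A W = M ∧ B W = N) {δ : ℝ} (hδ : 0 < δ) :
    ∃ W : E, ∀ Z, (∀ X, inner ℝ Z X = δ * fderiv ℝ (fderiv ℝ F) W Z X) → Z = 0 := by
  have hc : 0 < 2 / δ := by positivity
  rcases le_total p₁ p₀ with h | h
  · obtain ⟨A₀, hA₀⟩ := exists_mul_transpose_eq_smul_one h hc.le
    obtain ⟨W, hWA, hWB⟩ := hsurj A₀ 0
    refine ⟨W, fun Z hZ => ?_⟩
    -- The sign flip cancels the term containing `R`, and the scale `2 / δ` of `A₀ A₀ᵀ` leaves `-‖A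
    -- Z‖² + ‖B Z‖² = 2 ‖B Z‖²`.
    obtain ⟨X, hXA, hXB⟩ := hsurj (-A Z) (B Z)
    have h1 := hZ X
    rw [second_fderiv_two_layer hF hFeq hA hB, hinner, hXA, hXB, hWA, hWB] at h1
    have e1 : B Z * A Z + B Z * -A Z = 0 := by rw [Matrix.mul_neg, add_neg_cancel]
    have e2 : frobInner (B Z * A₀) (B Z * A₀) = 2 / δ * frobInner (B Z) (B Z) := by
      rw [frobInner_mul_right_eq, Matrix.mul_assoc, hA₀, Matrix.mul_smul, Matrix.mul_one,
        frobInner_smul_left]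
    have e3 : frobInner (A Z) (-A Z) = -frobInner (A Z) (A Z) := by
      rw [← neg_one_smul ℝ (A Z), frobInner_smul_right]
      ring
    have e4 : ∀ M : Matrix (Fin p₂) (Fin p₀) ℝ, frobInner M 0 = 0 := fun M => by
      simp [frobInner]
    rw [e1, e3, e4, Matrix.zero_mul, Matrix.zero_mul, add_zero, e2, sub_zero,
      ← mul_assoc, mul_div_cancel₀ _ hδ.ne'] at h1
    have h2 : inner ℝ Z Z = 0 := by
      rw [hinner]
      linarith [frobInner_self_nonneg (A Z), frobInner_self_nonneg (B Z)]
    exact inner_self_eq_zero.mp h2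
  · obtain ⟨A₁, hA₁⟩ := exists_mul_transpose_eq_smul_one h hc.le
    set A₀ := A₁ᵀ
    have hA₀ : A₀ᵀ * A₀ = (2 / δ) • (1 : Matrix (Fin p₀) (Fin p₀) ℝ) := by
      rw [transpose_transpose, hA₁]
    obtain ⟨W, hWA, hWB⟩ := hsurj A₀ ((2 / δ)⁻¹ • (R * A₀ᵀ))
    set B₀ := (2 / δ)⁻¹ • (R * A₀ᵀ) with hB₀
    -- With zero residual the Hessian is `J*J` for `J Z = B Z * A₀ + B₀ * A Z`, and `J J* ≥ 2 / δ`,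
    -- so `1 / δ` is not an eigenvalue. The test vector below is `J* M`.
    have hBA : B₀ * A₀ = R := by
      rw [hB₀, Matrix.smul_mul, Matrix.mul_assoc, hA₀, Matrix.mul_smul, Matrix.mul_one, smul_smul,
        inv_mul_cancel₀ hc.ne', one_smul]
    refine ⟨W, fun Z hZ => ?_⟩
    have e0 : ∀ K : Matrix (Fin p₂) (Fin p₀) ℝ, frobInner 0 K = 0 := fun K => by
      simp [frobInner]
    have key : ∀ X, inner ℝ Z X =
        δ * frobInner (B Z * A₀ + B₀ * A Z) (B X * A₀ + B₀ * A X) := by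
      intro X
      rw [hZ, second_fderiv_two_layer hF hFeq hA hB, hWA, hWB, hBA, sub_self, e0, sub_zero]
    set M := B Z * A₀ + B₀ * A Z with hM
    obtain ⟨X, hXA, hXB⟩ := hsurj (B₀ᵀ * M) (M * A₀ᵀ)
    have h1 := key X
    rw [hinner, hXA, hXB, Matrix.mul_assoc, hA₀, Matrix.mul_smul, Matrix.mul_one,
      frobInner_add_right, frobInner_smul_right, frobInner_mul_left_eq M] at h1
    have e1 : frobInner (A Z) (B₀ᵀ * M) + frobInner (B Z) (M * A₀ᵀ) = frobInner M M := by
      have h2 : frobInner M M = frobInner (B Z * A₀) M + frobInner (B₀ * A Z) M := by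
        rw [← frobInner_add_left]
      rw [frobInner_mul_left_eq, frobInner_mul_right_eq, transpose_transpose, transpose_transpose,
        h2, add_comm]
    rw [e1, mul_add, add_comm, ← mul_assoc, mul_div_cancel₀ _ hδ.ne'] at h1
    have hM0 : M = 0 := by
      rw [← frobInner_self_eq_zero]
      have := mul_nonneg hδ.le (frobInner_self_nonneg (B₀ᵀ * M))
      linarith [frobInner_self_nonneg M]
    have h3 := key Z
    rw [hM0, e0, mul_zero] at h3
    exact inner_self_eq_zero.mp h3

end TwoLayer

section

variable {m : ℕ} {n : Fin (m + 1 + 1) → ℕ}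

lemma partialProd_smul (W : Params n) (t : ℝ) (k : Fin (m + 1 + 1)) :
    partialProd (t • W) k = t ^ (k : ℕ) • partialProd W k := by
  induction k using Fin.induction with
  | zero => simp [partialProd_zero]
  | succ j ih =>
    have : weight (t • W) j = t • weight W j := rfl
    rw [partialProd_succ, ih, partialProd_succ, this, Matrix.smul_mul, Matrix.mul_smul, smul_smul,
      Fin.val_succ, Fin.val_castSucc, pow_succ']

/-- Curvature at the origin. -/
lemma second_fderiv_zero {R : Matrix (Fin (n (Fin.last (m + 1)))) (Fin (n 0)) ℝ} {F : Params n → ℝ}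
    (hF : F = fun W => 1 / 2 * frobInner (R - endToEnd W) (R - endToEnd W)) (Z : Params n) :
    fderiv ℝ (fderiv ℝ F) 0 Z Z = -((m + 1) * m * 0 ^ (m - 1) * frobInner R (endToEnd Z)) +
      (m + 1) * (2 * m + 1) * 0 ^ (2 * m) * frobInner (endToEnd Z) (endToEnd Z) := by
  set b := frobInner R (endToEnd Z)
  set c := frobInner (endToEnd Z) (endToEnd Z)
  have hcd : ContDiff ℝ ω F := hF ▸ contDiff_loss R
  have e : (fun t : ℝ => F (0 + t • Z)) = fun t =>
      1 / 2 * frobInner R R - t ^ (m + 1) * b + t ^ (2 * m + 2) * (1 / 2 * c) := by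
    funext t
    have h1 : endToEnd (t • Z) = t ^ (m + 1) • endToEnd Z := partialProd_smul Z t _
    simp only [hF, zero_add, h1, frobInner_sub_left, frobInner_sub_right, frobInner_smul_left,
      frobInner_smul_right]
    rw [frobInner_comm (endToEnd Z) R]
    ring
  have e' : deriv (fun t : ℝ => F (0 + t • Z)) = fun t =>
      -((m + 1) * t ^ m * b) + (m + 1) * t ^ (2 * m + 1) * c := by
    rw [e]
    funext t
    have h := (((hasDerivAt_pow (m + 1) t).mul_const b).const_sub (1 / 2 * frobInner R R)).add
      ((hasDerivAt_pow (2 * m + 2) t).mul_const (1 / 2 * c))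
    refine h.deriv.trans ?_
    push_cast
    ring
  rw [← deriv_deriv_along hcd, e']
  have h := (((hasDerivAt_pow m (0 : ℝ)).const_mul ((m : ℝ) + 1)).mul_const b).neg.add
      (((hasDerivAt_pow (2 * m + 1) (0 : ℝ)).const_mul ((m : ℝ) + 1)).mul_const c)
  refine h.deriv.trans ?_
  push_cast
  ring

/-- Somewhere the derivative of the gradient descent map is injective. -/
lemma exists_regular_point {R : Matrix (Fin (n (Fin.last (m + 1)))) (Fin (n 0)) ℝ}
    {F : Params n → ℝ}
    (hF : F = fun W => 1 / 2 * frobInner (R - endToEnd W) (R - endToEnd W)) {δ : ℝ} (hδ : 0 < δ)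
    (hδ1 : m = 0 → δ ≠ 1) :
    ∃ W : Params n, ∀ Z, (∀ X, inner ℝ Z X = δ * fderiv ℝ (fderiv ℝ F) W Z X) → Z = 0 := by
  have hcd : ContDiff ℝ ω F := hF ▸ contDiff_loss R
  -- The Hessian at the origin is the identity for one layer and has zero quadratic form for three
  -- or more. With two layers it depends on `R` and may have the eigenvalue `1 / δ`, so another
  -- point is used.
  match m, hδ1 with
  | 0, hδ1 =>
    refine ⟨0, fun Z hZ => ?_⟩
    have h1 := hZ Z
    have h2 : inner ℝ Z Z = frobInner (endToEnd Z) (endToEnd Z) := by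
      rw [inner_eq_sum_frobInner, Fin.sum_univ_one]
      have : endToEnd Z = firstWeight Z := partialProd_succ_zero Z
      rw [this]
      rfl
    rw [second_fderiv_zero hF, ← h2] at h1
    have h3 : (1 - δ) * inner ℝ Z Z = 0 := by
      simp only [CharP.cast_eq_zero, mul_zero, zero_mul, neg_zero, zero_add, pow_zero, one_mul,
        mul_one] at h1
      linarith
    exact inner_self_eq_zero.mp
      ((mul_eq_zero.mp h3).resolve_left (sub_ne_zero.mpr (hδ1 rfl).symm))
  | 1, _ =>
    refine exists_regular_point_two_layer (A := firstWeight) (B := lastWeight) (R := R) hcd ?_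
      (fun W Z t => rfl) (fun W Z t => rfl) (fun Z X => ?_) (fun M N => ?_) hδ
    · refine hF.trans (funext fun W => ?_)
      exact congrArg (fun P : Matrix (Fin (n (Fin.last 1).castSucc)) (Fin (n 0)) ℝ =>
        1 / 2 * frobInner (R - lastWeight W * P) (R - lastWeight W * P)) (partialProd_succ_zero W)
    · rw [inner_eq_sum_frobInner, Fin.sum_univ_two]
      rfl
    · exact ⟨ofWeights fun j => match j with
        | 0 => M
        | 1 => N, rfl, rfl⟩
  | k + 2, _ =>
    refine ⟨0, fun Z hZ => ?_⟩
    have h1 := hZ Z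
    rw [second_fderiv_zero hF] at h1
    simpa using h1

end

end DeepLinear

/-! ### Conclusion. -/

open DeepLinear in
theorem corollary1 (L N : ℕ) (hL : 1 ≤ L) (n : Fin (L + 1) → ℕ) (hn : ∀ j, 1 ≤ n j)
    (R : Matrix (Fin (n (Fin.last L))) (Fin (n 0)) ℝ) (hR : R ≠ 0)
    (x : Fin N → EuclideanSpace ℝ (Fin (n 0)))
    (hx : (1 / (N : ℝ)) • ∑ i, Matrix.vecMulVec (x i) (x i) = 1)
    (δ : ℝ)
    (μ : Measure (DeepLinear.Params n)) [IsProbabilityMeasure μ] (hμ : μ ≪ volume)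
    (hconv : μ {W₀ | DeepLinear.ConvergesToGlobalOptimum R x δ W₀} ≠ 0) :
    δ ≤ 2 / (L * DeepLinear.largestSingularValue R ^ (2 * ((L : ℝ) - 1) / L)) := by
  obtain ⟨m, rfl⟩ : ∃ m, L = m + 1 := ⟨L - 1, by omega⟩
  by_contra! hδ
  have hF := loss_eq (hn 0) R hx
  have hcd : ContDiff ℝ ω (loss R x) := hF ▸ contDiff_loss R
  have hρ := largestSingularValue_pos hR
  have hΛ : ((m + 1 : ℕ) : ℝ) * largestSingularValue R ^
      (2 * (((m + 1 : ℕ) : ℝ) - 1) / ((m + 1 : ℕ) : ℝ)) =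
      ((m : ℝ) + 1) * largestSingularValue R ^ (2 * (m : ℝ) / ((m : ℝ) + 1)) := by
    push_cast
    rw [add_sub_cancel_right]
  rw [hΛ] at hδ
  set Λ := ((m : ℝ) + 1) * largestSingularValue R ^ (2 * (m : ℝ) / ((m : ℝ) + 1)) with hΛdef
  have hΛ0 : 0 < Λ := by positivity
  have hδ0 : 0 < δ := lt_trans (by positivity) hδ
  rw [div_lt_iff₀ hΛ0] at hδ
  -- For one layer `Λ = 1`, so `2 < δ Λ` excludes `δ = 1`, the one step size for which the descent
  -- map is constant.
  obtain ⟨W₁, hW₁⟩ := exists_regular_point hF hδ0 (by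
    rintro rfl rfl
    simp [hΛdef] at hδ)
  refine hconv (hμ ?_)
  refine volume_gradientDescent_converges_eq_zero hcd δ {W | IsGlobalOptimum R x W} ?_ hW₁
  intro W hW
  obtain ⟨V, hV0, hV⟩ := exists_curvature_ge hn hR hF hW
  refine ⟨V, ?_⟩
  have hV1 : 0 < ‖V‖ ^ 2 := by
    have := norm_pos_iff.mpr hV0
    positivity
  calc 2 * ‖V‖ ^ 2 < δ * Λ * ‖V‖ ^ 2 := by gcongr
    _ = δ * (Λ * ‖V‖ ^ 2) := by ring
    _ ≤ _ := by gcongr
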